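/- Let $n\ge 2$. Let $\mathbb R^{n+1,n+1}=E\oplus F$ with $E=\mathbb R^{n+1}$, $F=(\mathbb R^{n+1})^*$ and the split form $h=\begin{pmatrix}0&I\\ I&0\end{pmatrix}$; let $v_+=(1,0,\dots,0)\in E$, $\tilde v_+=(1,0,\dots,0,1)\in\mathbb R^{n+1,n+1}$, $L=\mathbb R\tilde v_+$ and $\bar F=F\cap L^\perp$. Let $G=SL(n+1,\mathbb R)$, let $P\subset G$ be the stabiliser of the ray $\mathbb R_+v_+$, let $\tilde G=Spin(n+1,n+1)$, let $\tilde P\subset\tilde G$ be the stabiliser of the ray $\mathbb R_+\tilde v_+$, let $i:G\hookrightarrow\tilde G$ be the lift of $A\mapsto \mathrm{diag}(A,(A^{-1})^t)$, and let $Q=i^{-1}(\tilde P)\subset P$; denote the Lie algebras by $\mathfrak g,\mathfrak p,\tilde{\mathfrak g},\tilde{\mathfrak p},\mathfrak q$, and let $\tilde{\mathfrak p}_+$ be the orthogonal complement of $\tilde{\mathfrak p}$ for the Killing form of $\tilde{\mathfrak g}=\mathfrak{so}(n+1,n+1)\cong\Lambda^2\mathbb R^{n+1,n+1}$. Via $X\mapsto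 X\tilde v_+$ one has $\mathfrak g/\mathfrak q\cong\tilde{\mathfrak g}/\tilde{\mathfrak p}\cong L^*\otimes L^\perp/L$, so that $\tilde{\mathfrak g}/\tilde{\mathfrak p}$ carries the inner product $\langle X,Y\rangle=h(X\tilde v_+,Y\tilde v_+)$; use it to identify $(\tilde{\mathfrak g}/\tilde{\mathfrak p})^*$ with $\tilde{\mathfrak g}/\tilde{\mathfrak p}$. Let $f=\mathfrak p/\mathfrak q\subset\mathfrak g/\mathfrak q\cong\tilde{\mathfrak g}/\tilde{\mathfrak p}$ be the vertical subspace, and regard $\Lambda^2 f\subset\Lambda^2(L^\perp/L)$ as a subspace of $\tilde{\mathfrak g}_0=\tilde{\mathfrak p}/\tilde{\mathfrak p}_+$. Let $(\mathcal G\to M,\omega)$ be a normal projective Cartan geometry, that is, a Cartan geometry of type $(G,P)$ on an $n$-manifold $M$ whose curvature function $\kappa$ satisfies $\partial^*\kappa=0$ for the Kostant codifferential $\partial^*$. Let $\tilde{\mathcal G}=\mathcal G\times_Q\tilde P\to\mathcal G/Q$, let $\tilde\omega$ be the unique conformal Cartan connection of type $(\tilde G,\tilde P)$ on $\tilde{\mathcal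 G}$ that restricts to $\omega$ on $\mathcal G\subset\tilde{\mathcal G}$, and let $\tilde\kappa$ be its curvature function. Let $\tilde\partial^*$ be the Kostant codifferential for $(\tilde{\mathfrak g},\tilde{\mathfrak p})$. Then, for every $u\in\mathcal G$, the element $\tilde\partial^*\tilde\kappa(u)\in(\tilde{\mathfrak g}/\tilde{\mathfrak p})^*\otimes\tilde{\mathfrak p}$ lies in $$f\otimes\Lambda^2\bar F,$$ and its $\tilde{\mathfrak g}_0$-part $\tilde\partial^*\tilde\kappa_0(u)\in(\tilde{\mathfrak g}/\tilde{\mathfrak p})^*\otimes\tilde{\mathfrak g}_0$, the composition with $\tilde{\mathfrak p}\to\tilde{\mathfrak p}/\tilde{\mathfrak p}_+=\tilde{\mathfrak g}_0$, lies in $$f\otimes\Lambda^2 f.$$ -/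

import Mathlib

open scoped Manifold ContDiff Matrix

-- the commutator bracket on matrices
attribute [local instance 100] LieRing.ofAssociativeRing

noncomputable section

namespace ProjConf

/-! ## Cartan geometries with values in a Lie algebra of real matrices -/

section Forms

variable {E : Type*} [NormedAddCommGroup E] [NormedSpace ℝ E]
  {M : Type*} [TopologicalSpace M] [ChartedSpace E M]

/-- The exterior derivative `dα(ξ, η)` at `x` of a real 1-form `α` on the manifold `M`, computed in
the preferred chart `φ` at `x`: with `a = (φ⁻¹)^* α`, it is `D_ξ (a(η)) - D_η (a(ξ))` at `φ x`.
(In Mathlib, `T_x M` is the model space `E`, identified through the preferred chart at `x`.) -/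
def extDer (α : ∀ x : M, TangentSpace 𝓘(ℝ, E) x → ℝ) (x : M)
    (ξ η : TangentSpace 𝓘(ℝ, E) x) : ℝ :=
  let φ := extChartAt 𝓘(ℝ, E) x
  let a : E → E → ℝ := fun y v => α (φ.symm y) (mfderiv 𝓘(ℝ, E) 𝓘(ℝ, E) φ.symm y v)
  fderiv ℝ (fun y => a y η) (φ x) ξ - fderiv ℝ (fun y => a y ξ) (φ x) η

end Forms

section Cartan

variable {N : Type*} [Fintype N] [DecidableEq N]

/-- The Lie algebra of the stabiliser of the ray through `v`, inside a matrix Lie algebra `𝔤`: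
all `A ∈ 𝔤` with `A v ∈ ℝ v`. -/
def rayStab (𝔤 : LieSubalgebra ℝ (Matrix N N ℝ)) (v : N → ℝ) : Submodule ℝ 𝔤 where
  carrier := {A | ∃ c : ℝ, (A : Matrix N N ℝ) *ᵥ v = c • v}
  add_mem' := by
    rintro A B ⟨a, ha⟩ ⟨b, hb⟩
    exact ⟨a + b, by simp [Matrix.add_mulVec, ha, hb, add_smul]⟩
  zero_mem' := ⟨0, by simp⟩
  smul_mem' := by
    rintro r A ⟨a, ha⟩
    exact ⟨r * a, by simp [Matrix.smul_mulVec, ha, mul_smul]⟩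

/-- `𝔭₊`, the orthogonal complement of `𝔭` in `𝔤` for the Killing form of `𝔤`. -/
def pPlus {𝔤 : LieSubalgebra ℝ (Matrix N N ℝ)} (𝔭 : Submodule ℝ 𝔤) : Submodule ℝ 𝔤 :=
  (killingForm ℝ 𝔤).orthogonal 𝔭

/-- `X₁, …, X_d ∈ 𝔤` induce a basis of `𝔤 / 𝔭`, and `Z₁, …, Z_d ∈ 𝔭₊` is the dual basis under
the identification `(𝔤 / 𝔭)^* ≅ 𝔭₊` given by the Killing form. -/
structure IsDualPair {𝔤 : LieSubalgebra ℝ (Matrix N N ℝ)} (𝔭 : Submodule ℝ 𝔤)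
    {ι : Type*} [DecidableEq ι] (X Z : ι → 𝔤) : Prop where
  linearIndependent : LinearIndependent ℝ fun i => 𝔭.mkQ (X i)
  span_eq_top : Submodule.span ℝ (Set.range fun i => 𝔭.mkQ (X i)) = ⊤
  mem_pPlus : ∀ i, Z i ∈ pPlus 𝔭
  killing : ∀ i j, killingForm ℝ 𝔤 (Z i) (X j) = if i = j then 1 else 0

/-- The Kostant codifferential of a 2-cochain `κ`, given by a function on pairs of representatives
in `𝔤` of classes in `𝔤 / 𝔭`, in terms of a pair of dual bases `X`, `Z`:
`(∂^* κ)(Y) = 2 ∑ [κ(X_i, Y), Z_i] + ∑ κ(X_i, [Z_i, Y])`.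
(For alternating bilinear `κ` that vanishes on `𝔭`, it does not depend on `X` and `Z`.) -/
def codiff {𝔤 : LieSubalgebra ℝ (Matrix N N ℝ)} {ι : Type*} [Fintype ι]
    (X Z : ι → 𝔤) (κ : 𝔤 → 𝔤 → Matrix N N ℝ) (Y : 𝔤) : Matrix N N ℝ :=
  (2 : ℝ) • ∑ i, ⁅κ (X i) Y, (Z i : Matrix N N ℝ)⁆ + ∑ i, κ (X i) ⁅Z i, Y⁆

variable {EH : Type*} [NormedAddCommGroup EH] [NormedSpace ℝ EH]
  {H : Type*} [TopologicalSpace H] [ChartedSpace EH H] [Group H]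

/-- The derivative at `1` of a matrix representation `ρ` of a Lie group `H`, entry by entry. -/
def dRep (ρ : H →* Matrix N N ℝ) (ζ : TangentSpace 𝓘(ℝ, EH) (1 : H)) : Matrix N N ℝ :=
  Matrix.of fun i j => mfderiv 𝓘(ℝ, EH) 𝓘(ℝ, ℝ) (fun h : H => ρ h i j) 1 ζ

variable (EH) in
/-- The representation `ρ` is smooth, and its derivative identifies `T₁H` with the Lie algebra
`𝔥 ⊆ 𝔤`. -/
structure IsLieRep (ρ : H →* Matrix N N ℝ) {𝔤 : LieSubalgebra ℝ (Matrix N N ℝ)}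
    (𝔥 : Submodule ℝ 𝔤) : Prop where
  smooth : ∀ i j, ContMDiff 𝓘(ℝ, EH) 𝓘(ℝ, ℝ) ∞ fun h : H => ρ h i j
  injective : Function.Injective
    (dRep ρ : TangentSpace 𝓘(ℝ, EH) (1 : H) → Matrix N N ℝ)
  range_eq : Set.range (dRep ρ : TangentSpace 𝓘(ℝ, EH) (1 : H) → Matrix N N ℝ) =
    {A | ∃ B ∈ 𝔥, (B : Matrix N N ℝ) = A}

variable {E : Type*} [NormedAddCommGroup E] [NormedSpace ℝ E]
  {𝒢 : Type*} [TopologicalSpace 𝒢] [ChartedSpace E 𝒢]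

variable (EH E) in
/-- A smooth right action of the Lie group `H` on the manifold `𝒢`. -/
structure IsSmoothRightAction (act : 𝒢 → H → 𝒢) : Prop where
  act_one : ∀ u, act u 1 = u
  act_mul : ∀ u g h, act u (g * h) = act (act u g) h
  smooth : ContMDiff (𝓘(ℝ, E).prod 𝓘(ℝ, EH)) 𝓘(ℝ, E) ∞ fun z : 𝒢 × H => act z.1 z.2

variable (EH E) in
/-- `π : 𝒢 → M` is a smooth principal `H`-bundle for the right action `act`: there are
equivariant local trivialisations `π⁻¹(U) ≅ U × H`. -/
structure IsPrincipalBundle {EM : Type*} [NormedAddCommGroup EM] [NormedSpace ℝ EM]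
    {M : Type*} [TopologicalSpace M] [ChartedSpace EM M]
    (π : 𝒢 → M) (act : 𝒢 → H → 𝒢) : Prop extends IsSmoothRightAction EH E act where
  smooth_proj : ContMDiff 𝓘(ℝ, E) 𝓘(ℝ, EM) ∞ π
  trivial : ∀ x : M, ∃ (U : Set M) (e : OpenPartialHomeomorph 𝒢 (M × H)), x ∈ U ∧
    e.source = π ⁻¹' U ∧ e.target = U ×ˢ Set.univ ∧
    ContMDiffOn 𝓘(ℝ, E) (𝓘(ℝ, EM).prod 𝓘(ℝ, EH)) ∞ e e.source ∧
    ContMDiffOn (𝓘(ℝ, EM).prod 𝓘(ℝ, EH)) 𝓘(ℝ, E) ∞ e.symm e.target ∧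
    ∀ u ∈ π ⁻¹' U, (e u).1 = π u ∧ ∀ h : H, e (act u h) = (π u, (e u).2 * h)

variable [IsManifold 𝓘(ℝ, E) ∞ 𝒢]

variable (EH E) in
/-- A `𝔤`-valued Cartan connection for the right action `act` of `H` on `𝒢`, where the
representation `ρ` of `H` induces the adjoint action of `H` on `𝔤` (by conjugation) and its
derivative identifies the Lie algebra of `H` with a subalgebra of `𝔤`. -/
structure CartanConnection (𝔤 : LieSubalgebra ℝ (Matrix N N ℝ)) (ρ : H →* Matrix N N ℝ)
    (act : 𝒢 → H → 𝒢) where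
  /-- the linear isomorphism `ω(u) : T_u 𝒢 → 𝔤` -/
  form : ∀ u : 𝒢, TangentSpace 𝓘(ℝ, E) u ≃ₗ[ℝ] 𝔤
  smooth : ∀ i j, ContMDiff 𝓘(ℝ, E).tangent 𝓘(ℝ, ℝ) ∞
    fun v : TangentBundle 𝓘(ℝ, E) 𝒢 => (form v.1 v.2 : Matrix N N ℝ) i j
  equivariant : ∀ (u : 𝒢) (h : H) (ξ : TangentSpace 𝓘(ℝ, E) u),
    (form (act u h) (mfderiv 𝓘(ℝ, E) 𝓘(ℝ, E) (fun x => act x h) u ξ) : Matrix N N ℝ) =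
      ρ h⁻¹ * (form u ξ : Matrix N N ℝ) * ρ h
  fundamental : ∀ (u : 𝒢) (ζ : TangentSpace 𝓘(ℝ, EH) (1 : H)),
    (form (act u 1) (mfderiv 𝓘(ℝ, EH) 𝓘(ℝ, E) (fun h => act u h) 1 ζ) : Matrix N N ℝ) =
      dRep ρ ζ

namespace CartanConnection

variable {𝔤 : LieSubalgebra ℝ (Matrix N N ℝ)} {ρ : H →* Matrix N N ℝ} {act : 𝒢 → H → 𝒢}

/-- The curvature `K(ξ, η) = dω(ξ, η) + [ω(ξ), ω(η)]`. -/
def curv (conn : CartanConnection EH E 𝔤 ρ act) (u : 𝒢) (ξ η : TangentSpace 𝓘(ℝ, E) u) :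
    Matrix N N ℝ :=
  (Matrix.of fun i j => extDer (fun x v => (conn.form x v : Matrix N N ℝ) i j) u ξ η) +
    ⁅(conn.form u ξ : Matrix N N ℝ), (conn.form u η : Matrix N N ℝ)⁆

/-- The curvature function `κ(u)(X, Y) = K(ω(u)⁻¹ X, ω(u)⁻¹ Y)`, on representatives
`X, Y ∈ 𝔤` of classes in `𝔤 / 𝔭`. -/
def curvFun (conn : CartanConnection EH E 𝔤 ρ act) (u : 𝒢) (X Y : 𝔤) : Matrix N N ℝ :=
  conn.curv u ((conn.form u).symm X) ((conn.form u).symm Y)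

/-- The normalisation condition `∂^* κ = 0`. -/
def IsNormal (conn : CartanConnection EH E 𝔤 ρ act) (𝔭 : Submodule ℝ 𝔤) : Prop :=
  ∀ X Z : Fin (Module.finrank ℝ (𝔤 ⧸ 𝔭)) → 𝔤, IsDualPair 𝔭 X Z →
    ∀ (u : 𝒢) (Y : 𝔤), codiff X Z (conn.curvFun u) Y = 0

end CartanConnection

end Cartan

/-! ## The Lie groups and Lie algebras -/

section Groups

variable (n : ℕ)

/-- `𝔤 = 𝔰𝔩(n+1, ℝ)`. -/
abbrev slAlg : LieSubalgebra ℝ (Matrix (Fin (n + 1)) (Fin (n + 1)) ℝ) :=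
  LieAlgebra.SpecialLinear.sl (Fin (n + 1)) ℝ

/-- Indices of the standard basis of `ℝ^{n+1,n+1} = E ⊕ F`, with `E = ℝ^{n+1}` and
`F = (ℝ^{n+1})^*`. -/
abbrev Idx : Type := Fin (n + 1) ⊕ Fin (n + 1)

/-- `𝔤̃ = 𝔰𝔬(n+1, n+1)`, for the split form `h` with matrix `(0, 1; 1, 0)`. -/
abbrev soAlg : LieSubalgebra ℝ (Matrix (Idx n) (Idx n) ℝ) :=
  LieAlgebra.Orthogonal.typeD (Fin (n + 1)) ℝ

/-- The bilinear form `h` of signature `(n+1, n+1)`. -/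
def hForm (v w : Idx n → ℝ) : ℝ := v ⬝ᵥ (LieAlgebra.Orthogonal.JD (Fin (n + 1)) ℝ *ᵥ w)

/-- `v₊ = (1, 0, …, 0) ∈ ℝ^{n+1}`. -/
def vPlus : Fin (n + 1) → ℝ := Pi.single 0 1

/-- The null vector `ṽ₊ = (1, 0, …, 0, 1) ∈ ℝ^{n+1,n+1}`. -/
def vTilde : Idx n → ℝ := Sum.elim (Pi.single 0 1) (Pi.single (Fin.last n) 1)

/-- `𝔭 ⊆ 𝔰𝔩(n+1)`. -/
abbrev slP : Submodule ℝ (slAlg n) := rayStab (slAlg n) (vPlus n)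

/-- `𝔭̃ ⊆ 𝔰𝔬(n+1, n+1)`. -/
abbrev soP : Submodule ℝ (soAlg n) := rayStab (soAlg n) (vTilde n)

/-- `P ⊆ SL(n+1)`, the stabiliser of the ray through `v₊`. -/
def PGrp : Subgroup (Matrix.SpecialLinearGroup (Fin (n + 1)) ℝ) where
  carrier := {g | ∃ c : ℝ, 0 < c ∧ g.1 *ᵥ vPlus n = c • vPlus n}
  one_mem' := ⟨1, one_pos, by simp⟩
  mul_mem' := by
    rintro g k ⟨a, ha, hga⟩ ⟨b, hb, hkb⟩
    refine ⟨a * b, mul_pos ha hb, ?_⟩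
    rw [Matrix.SpecialLinearGroup.coe_mul, ← Matrix.mulVec_mulVec, hkb, Matrix.mulVec_smul, hga,
      smul_smul, mul_comm]
  inv_mem' := by
    rintro g ⟨a, ha, hga⟩
    refine ⟨a⁻¹, inv_pos.2 ha, ?_⟩
    have h1 : (g⁻¹).1 *ᵥ (g.1 *ᵥ vPlus n) = vPlus n := by
      rw [Matrix.mulVec_mulVec, ← Matrix.SpecialLinearGroup.coe_mul, inv_mul_cancel]
      simp
    rw [hga, Matrix.mulVec_smul] at h1
    rw [← h1, smul_smul, inv_mul_cancel₀ ha.ne', one_smul, h1]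

/-- The standard representation of `P` on `ℝ^{n+1}`. -/
def PRep : PGrp n →* Matrix (Fin (n + 1)) (Fin (n + 1)) ℝ where
  toFun g := g.1.1
  map_one' := rfl
  map_mul' _ _ := rfl

/-- The inclusion `SL(n+1) → SO(n+1, n+1)`, `A ↦ diag(A, (A⁻¹)ᵗ)`. -/
def bigSL (g : Matrix.SpecialLinearGroup (Fin (n + 1)) ℝ) : Matrix (Idx n) (Idx n) ℝ :=
  Matrix.fromBlocks g.1 0 0 (g⁻¹).1ᵀ

/-- The inclusion `i' : 𝔰𝔩(n+1) → 𝔰𝔬(n+1, n+1)`, `A ↦ diag(A, -Aᵗ)`. -/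
def bigsl (A : Matrix (Fin (n + 1)) (Fin (n + 1)) ℝ) : Matrix (Idx n) (Idx n) ℝ :=
  Matrix.fromBlocks A 0 0 (-Aᵀ)

theorem bigSL_mul (g k : Matrix.SpecialLinearGroup (Fin (n + 1)) ℝ) :
    bigSL n (g * k) = bigSL n g * bigSL n k := by
  simp [bigSL, Matrix.fromBlocks_multiply, mul_inv_rev, -Matrix.SpecialLinearGroup.coe_inv]

theorem bigSL_one : bigSL n 1 = 1 := by
  simp [bigSL, -Matrix.SpecialLinearGroup.coe_inv]

/-- `Q ⊆ P`, the preimage under `SL(n+1) → SO(n+1, n+1)` of the stabiliser of the ray through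
`ṽ₊` (which is contained in `P`). -/
def QGrp : Subgroup (PGrp n) where
  carrier := {g | ∃ c : ℝ, 0 < c ∧ bigSL n g.1 *ᵥ vTilde n = c • vTilde n}
  one_mem' := ⟨1, one_pos, by simp [bigSL_one]⟩
  mul_mem' := by
    rintro g k ⟨a, ha, hga⟩ ⟨b, hb, hkb⟩
    refine ⟨a * b, mul_pos ha hb, ?_⟩
    rw [Subgroup.coe_mul, bigSL_mul, ← Matrix.mulVec_mulVec, hkb, Matrix.mulVec_smul, hga,
      smul_smul, mul_comm]
  inv_mem' := by
    rintro g ⟨a, ha, hga⟩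
    refine ⟨a⁻¹, inv_pos.2 ha, ?_⟩
    have h1 : bigSL n (g⁻¹).1 *ᵥ (bigSL n g.1 *ᵥ vTilde n) = vTilde n := by
      rw [Matrix.mulVec_mulVec, ← bigSL_mul, ← Subgroup.coe_mul, inv_mul_cancel]
      simp [bigSL_one]
    rw [hga, Matrix.mulVec_smul] at h1
    rw [← h1, smul_smul, inv_mul_cancel₀ ha.ne', one_smul, h1]

/-- The quadratic form `v ↦ h(v, v)` on `ℝ^{n+1,n+1}`. -/
abbrev hQuad : QuadraticForm ℝ (Idx n → ℝ) :=
  (LieAlgebra.Orthogonal.JD (Fin (n + 1)) ℝ).toQuadraticForm'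

/-- The linear left inverse `Cl → ℝ^{n+1,n+1}` of the inclusion of vectors in the Clifford
algebra. -/
def clVec : CliffordAlgebra (hQuad n) →ₗ[ℝ] (Idx n → ℝ) :=
  ExteriorAlgebra.ιInv ∘ₗ (CliffordAlgebra.equivExterior (hQuad n)).toLinearMap

theorem clVec_ι (v : Idx n → ℝ) : clVec n (CliffordAlgebra.ι (hQuad n) v) = v := by
  show ExteriorAlgebra.ιInv (CliffordAlgebra.changeForm CliffordAlgebra.changeForm.associated_neg_proof
    (CliffordAlgebra.ι (hQuad n) v)) = v
  rw [CliffordAlgebra.changeForm_ι]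
  exact ExteriorAlgebra.ι_leftInverse v

/-- `v ↦ x v x⁻¹` for `x ∈ Spin(n+1, n+1)`. -/
def spinVec (x : spinGroup (hQuad n)) : (Idx n → ℝ) →ₗ[ℝ] (Idx n → ℝ) :=
  clVec n ∘ₗ LinearMap.mulLeft ℝ x.1 ∘ₗ LinearMap.mulRight ℝ (x⁻¹).1 ∘ₗ
    CliffordAlgebra.ι (hQuad n)

theorem ι_spinVec (x : spinGroup (hQuad n)) (v : Idx n → ℝ) :
    CliffordAlgebra.ι (hQuad n) (spinVec n x v) =
      x.1 * CliffordAlgebra.ι (hQuad n) v * (x⁻¹).1 := by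
  have hx : ((spinGroup.toUnits x : (CliffordAlgebra (hQuad n))ˣ) : CliffordAlgebra (hQuad n)) ∈
      spinGroup (hQuad n) := x.2
  obtain ⟨w, hw⟩ := spinGroup.conjAct_smul_ι_mem_range_ι hx v
  rw [ConjAct.units_smul_def, ConjAct.ofConjAct_toConjAct] at hw
  have h2 : x.1 * CliffordAlgebra.ι (hQuad n) v * (x⁻¹).1 = CliffordAlgebra.ι (hQuad n) w :=
    hw.symm
  have h3 : spinVec n x v = w := by
    rw [← clVec_ι n w, ← h2]
    simp [spinVec, mul_assoc]
  rw [h2, h3]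

/-- The vector representation `Spin(n+1, n+1) → SO(n+1, n+1)`. -/
def spinRep : spinGroup (hQuad n) →* Matrix (Idx n) (Idx n) ℝ where
  toFun x := LinearMap.toMatrix' (spinVec n x)
  map_one' := by
    rw [← LinearMap.toMatrix'_id]
    congr 1
    refine LinearMap.ext fun v => ?_
    have h := congrArg (clVec n) (ι_spinVec n 1 v)
    simpa [clVec_ι] using h
  map_mul' x y := by
    rw [← LinearMap.toMatrix'_comp]
    congr 1
    refine LinearMap.ext fun v => ?_
    have h := congrArg (clVec n) (ι_spinVec n (x * y) v)
    have h' := congrArg (clVec n) (ι_spinVec n x (spinVec n y v))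
    rw [clVec_ι] at h h'
    rw [LinearMap.comp_apply, h, h', ι_spinVec]
    simp [mul_inv_rev, mul_assoc]

/-- `P̃ ⊆ Spin(n+1, n+1)`, the stabiliser of the ray through `ṽ₊`. -/
def PtGrp : Subgroup (spinGroup (hQuad n)) where
  carrier := {x | ∃ c : ℝ, 0 < c ∧ spinRep n x *ᵥ vTilde n = c • vTilde n}
  one_mem' := ⟨1, one_pos, by simp⟩
  mul_mem' := by
    rintro g k ⟨a, ha, hga⟩ ⟨b, hb, hkb⟩
    refine ⟨a * b, mul_pos ha hb, ?_⟩
    rw [map_mul, ← Matrix.mulVec_mulVec, hkb, Matrix.mulVec_smul, hga, smul_smul, mul_comm]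
  inv_mem' := by
    rintro g ⟨a, ha, hga⟩
    refine ⟨a⁻¹, inv_pos.2 ha, ?_⟩
    have h1 : spinRep n g⁻¹ *ᵥ (spinRep n g *ᵥ vTilde n) = vTilde n := by
      rw [Matrix.mulVec_mulVec, ← map_mul, inv_mul_cancel]
      simp
    rw [hga, Matrix.mulVec_smul] at h1
    rw [← h1, smul_smul, inv_mul_cancel₀ ha.ne', one_smul, h1]

/-- The representation of `P̃` on `ℝ^{n+1,n+1}`. -/
def PtRep : PtGrp n →* Matrix (Idx n) (Idx n) ℝ := (spinRep n).comp (PtGrp n).subtype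

end Groups

/-! ## The Fefferman-type construction -/

section Fefferman

variable {n : ℕ}
  {EP : Type*} [NormedAddCommGroup EP] [NormedSpace ℝ EP] [ChartedSpace EP (PGrp n)]
  {ET : Type*} [NormedAddCommGroup ET] [NormedSpace ℝ ET]
  [TopologicalSpace (PtGrp n)] [ChartedSpace ET (PtGrp n)]
  {E : Type*} [NormedAddCommGroup E] [NormedSpace ℝ E]
  {𝒢 : Type*} [TopologicalSpace 𝒢] [ChartedSpace E 𝒢] [IsManifold 𝓘(ℝ, E) ∞ 𝒢]
  {E' : Type*} [NormedAddCommGroup E'] [NormedSpace ℝ E']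
  {𝒢' : Type*} [TopologicalSpace 𝒢'] [ChartedSpace E' 𝒢'] [IsManifold 𝓘(ℝ, E') ∞ 𝒢']

variable (ET E E') in
/-- The manifold `𝒢'` with the right action `act'` of `P̃` is the extended bundle
`𝒢 ×_Q P̃ → 𝒢 / Q`, with canonical map `j : 𝒢 → 𝒢 ×_Q P̃`, `u ↦ [u, 1]`. That is, `𝒢'` is the
quotient manifold of `𝒢 × P̃` by the relation `(u q, p) ∼ (u, i(q) p)` for `q ∈ Q`, with projection
`(u, p) ↦ j(u) p`. -/
structure IsExtendedBundle (i : QGrp n →* PtGrp n) (act : 𝒢 → PGrp n → 𝒢)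
    (act' : 𝒢' → PtGrp n → 𝒢') (j : 𝒢 → 𝒢') : Prop
    extends IsSmoothRightAction ET E' act' where
  smooth_j : ContMDiff 𝓘(ℝ, E) 𝓘(ℝ, E') ∞ j
  surjective : ∀ w : 𝒢', ∃ (u : 𝒢) (p : PtGrp n), act' (j u) p = w
  submersion : ∀ z : 𝒢 × PtGrp n, Function.Surjective
    (mfderiv (𝓘(ℝ, E).prod 𝓘(ℝ, ET)) 𝓘(ℝ, E')
      (fun z : 𝒢 × PtGrp n => act' (j z.1) z.2) z)
  fibre : ∀ (u u' : 𝒢) (p p' : PtGrp n), act' (j u) p = act' (j u') p' ↔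
    ∃ q : QGrp n, u' = act u q ∧ p = i q * p'

/-- `conn'` is the equivariant extension of `conn`: its pullback along `j` is `i' ∘ conn`. -/
def IsInducedConnection {act : 𝒢 → PGrp n → 𝒢} {act' : 𝒢' → PtGrp n → 𝒢'}
    (j : 𝒢 → 𝒢') (conn : CartanConnection EP E (slAlg n) (PRep n) act)
    (conn' : CartanConnection ET E' (soAlg n) (PtRep n) act') : Prop :=
  ∀ (u : 𝒢) (ξ : TangentSpace 𝓘(ℝ, E) u),
    (conn'.form (j u) (mfderiv 𝓘(ℝ, E) 𝓘(ℝ, E') j u ξ) : Matrix (Idx n) (Idx n) ℝ) =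
      bigsl n (conn.form u ξ)

end Fefferman

/-! ## The subspaces in the result -/

section Subspaces

variable (n : ℕ)

/-- `F̄ = F ∩ L^⊥`, where `L = ℝ ṽ₊`. -/
def FBar : Submodule ℝ (Idx n → ℝ) where
  carrier := {w | (∀ a, w (Sum.inl a) = 0) ∧ hForm n (vTilde n) w = 0}
  add_mem' := by
    rintro v w ⟨h1, h2⟩ ⟨h3, h4⟩
    refine ⟨fun a => by simp [h1, h3], ?_⟩
    simp only [hForm, Matrix.mulVec_add, dotProduct_add] at *
    simp [h2, h4]
  zero_mem' := by simp [hForm]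
  smul_mem' := by
    rintro c v ⟨h1, h2⟩
    refine ⟨fun a => by simp [h1], ?_⟩
    simp only [hForm, Matrix.mulVec_smul, dotProduct_smul] at *
    simp [h2]

/-- `v ∧ w` as the skew-symmetric endomorphism `x ↦ h(v, x) w - h(w, x) v`, under
`Λ² ℝ^{n+1,n+1} ≅ 𝔰𝔬(n+1, n+1)`. -/
def wedge (v w : Idx n → ℝ) : Matrix (Idx n) (Idx n) ℝ :=
  Matrix.vecMulVec w (LieAlgebra.Orthogonal.JD (Fin (n + 1)) ℝ *ᵥ v) -
    Matrix.vecMulVec v (LieAlgebra.Orthogonal.JD (Fin (n + 1)) ℝ *ᵥ w)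

/-- The bilinear form `⟨X, Y⟩ = h(X ṽ₊, Y ṽ₊)` on `𝔤̃ / 𝔭̃ ≅ L^* ⊗ L^⊥ / L`, which represents its
conformal class of inner products (`X` and `Y` are representatives in `𝔤̃`). -/
def confForm (X Y : Matrix (Idx n) (Idx n) ℝ) : ℝ :=
  hForm n (X *ᵥ vTilde n) (Y *ᵥ vTilde n)

/-- `f ⊗ Λ² F̄`, as a space of maps `𝔤̃ → 𝔤̃` that factor through `𝔤̃ / 𝔭̃`. Here
`f = 𝔭 / 𝔮 ⊆ 𝔤 / 𝔮 ≅ 𝔤̃ / 𝔭̃`, and `a ∈ f` is viewed as the functional `⟨a, ·⟩` on `𝔤̃ / 𝔭̃`. -/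
def fTensorWedgeFBar : Submodule ℝ (soAlg n → Matrix (Idx n) (Idx n) ℝ) :=
  Submodule.span ℝ {θ | ∃ a ∈ slP n, ∃ w ∈ FBar n, ∃ w' ∈ FBar n,
    θ = fun X : soAlg n => confForm n (bigsl n a) X • wedge n w w'}

/-- `𝔭̃₊` as a space of matrices. -/
def soPPlus : Submodule ℝ (Matrix (Idx n) (Idx n) ℝ) :=
  (pPlus (soP n)).map (soAlg n).toSubmodule.subtype

/-- `f ⊗ Λ² f`, as a space of maps from `𝔤̃` (factoring through `𝔤̃ / 𝔭̃`) to
`𝔤̃₀ = 𝔭̃ / 𝔭̃₊ ⊆ 𝔤𝔩 / 𝔭̃₊`. Elements `b, c ∈ f = 𝔭 / 𝔮` correspond to the classes of `b ṽ₊` and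
`c ṽ₊` in `L^⊥ / L`, and `b ∧ c ∈ Λ² (L^⊥ / L) ⊆ 𝔤̃₀` is the class of
`(b ṽ₊) ∧ (c ṽ₊) ∈ Λ² L^⊥ ⊆ 𝔭̃` modulo `𝔭̃₊ = L ∧ L^⊥`. -/
def fTensorWedgeF : Submodule ℝ (soAlg n → Matrix (Idx n) (Idx n) ℝ ⧸ soPPlus n) :=
  Submodule.span ℝ {θ | ∃ a ∈ slP n, ∃ b ∈ slP n, ∃ c ∈ slP n,
    θ = fun X : soAlg n => confForm n (bigsl n a) X •
      (soPPlus n).mkQ (wedge n (bigsl n b *ᵥ vTilde n) (bigsl n c *ᵥ vTilde n))}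

end Subspaces

end ProjConf

end

/-!
The codifferential only involves the curvature `κ̃(j(u))` on `𝔤̃ / 𝔭̃`, and two general facts
determine it from the projective curvature `κ(u)`.

* The curvature is natural: the exterior derivative commutes with pullback
  (`IsSmoothOneForm.extDer_pullback`), so `κ̃(j(u))` on `𝔰𝔩(n+1) ⊆ 𝔰𝔬(n+1, n+1)` is the image of
  `κ(u)` (`curvBilin_induced`).
* The curvature is horizontal: it vanishes as soon as one argument is in the Lie algebra of the
  structure group (`CartanConnection.curvFun_eq_zero_of_eq_dRep`). This follows from naturality for
  the map `(x, h) ↦ x h` and the derivative of the equivariance in `h`.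

As `𝔰𝔩(n+1) + 𝔭̃ = 𝔰𝔬(n+1, n+1)`, this describes `κ̃(j(u))` completely. The codifferential does not
depend on the dual bases (`IsDualPair.codiff_eq`, by nondegeneracy of the Killing form), so it may
be computed in bases adapted to the decomposition of `L^⊥ / L` into two isotropic halves: the vertical
half `f`, spanned by the classes of `f^1, …, f^n`, on which `κ̃` vanishes, and a complement spanned
by the classes of the matrix units `E_{i0} ∈ 𝔰𝔩(n+1)`. The element of `𝔭̃₊` dual to `E_{i0}` is a
multiple of `ṽ₊ ∧ f^i`, so that

  `(∂̃^* κ̃)(Y) = c ∑ [K_i, ṽ₊ ∧ f^i]`, with `K_i = κ(E_{i0}, Y)`.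

For the projective geometry, the equation `∂^* κ = 0` read entry by entry says that the `K_i` lie
in `𝔭` (`torsion_eq_zero`) and satisfy a trace condition (`sum_curvature_eq`). No Bianchi
identity is needed: inserting both in the sum, the terms outside `Λ² F̄` combine to a multiple of
`(e_0 - ṽ₊) ∧ f^l = -f^n ∧ f^l` (`sum_lie_wedge`). What is left lies in `Λ² F̄`, and depends on `Y`
only through its class modulo `𝔭`, that is, through an element of `f^⊥ = f`. Finally the `f^b` are
themselves of the form `B ṽ₊` with `B ∈ 𝔭` (`exists_mem_slP_mulVec_eq_fVec`), so the same formula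
gives both assertions.
-/

/-! ### Killing forms of `𝔰𝔩(n+1)` and `𝔰𝔬(n+1, n+1)` -/

namespace ProjConf

section MatrixTraces

variable {N : Type*} [Fintype N] [DecidableEq N]

/-- The trace of an endomorphism of the space of matrices, computed on matrix units. -/
theorem trace_end_matrix (T : Matrix N N ℝ →ₗ[ℝ] Matrix N N ℝ) :
    LinearMap.trace ℝ _ T = ∑ i, ∑ j, T (Matrix.single i j 1) i j := by
  rw [LinearMap.trace_eq_matrix_trace ℝ (Matrix.stdBasis ℝ N N), Matrix.trace,
    Fintype.sum_prod_type]
  refine Finset.sum_congr rfl fun i _ => Finset.sum_congr rfl fun j _ => ?_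
  rw [Matrix.diag_apply, LinearMap.toMatrix_apply, Matrix.stdBasis_eq_single]
  simp [Matrix.stdBasis]

/-- The endomorphism `M ↦ A M B` of the space of matrices. -/
def mulLR (A B : Matrix N N ℝ) : Matrix N N ℝ →ₗ[ℝ] Matrix N N ℝ :=
  LinearMap.mulLeft ℝ A ∘ₗ LinearMap.mulRight ℝ B

/-- The endomorphism `M ↦ A Mᵀ B` of the space of matrices. -/
def mulTransposeLR (A B : Matrix N N ℝ) : Matrix N N ℝ →ₗ[ℝ] Matrix N N ℝ :=
  mulLR A B ∘ₗ (Matrix.transposeLinearEquiv N N ℝ ℝ).toLinearMap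

@[simp]
theorem mulLR_apply (A B M : Matrix N N ℝ) : mulLR A B M = A * (M * B) := rfl

@[simp]
theorem mulTransposeLR_apply (A B M : Matrix N N ℝ) : mulTransposeLR A B M = A * (Mᵀ * B) := rfl

theorem trace_mulLR (A B : Matrix N N ℝ) :
    LinearMap.trace ℝ _ (mulLR A B) = A.trace * B.trace := by
  rw [trace_end_matrix, Matrix.trace, Matrix.trace, Finset.sum_mul_sum]
  refine Finset.sum_congr rfl fun i _ => Finset.sum_congr rfl fun j _ => ?_
  simp [Matrix.mul_apply, Matrix.single_apply, ite_and]

theorem trace_mulTransposeLR (A B : Matrix N N ℝ) :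
    LinearMap.trace ℝ _ (mulTransposeLR A B) = (Aᵀ * B).trace := by
  rw [trace_end_matrix, Matrix.trace, Finset.sum_comm]
  refine Finset.sum_congr rfl fun i _ => ?_
  rw [Matrix.diag_apply, Matrix.mul_apply]
  refine Finset.sum_congr rfl fun j _ => ?_
  simp [Matrix.mul_apply, Matrix.single_apply, ite_and]

/-- The Killing form of a matrix Lie algebra `𝔤` as a trace over all matrices, for any linear
projection `p` onto `𝔤`. -/
theorem killingForm_eq_trace (𝔤 : LieSubalgebra ℝ (Matrix N N ℝ)) (p : Matrix N N ℝ →ₗ[ℝ] 𝔤)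
    (hp : ∀ A : 𝔤, p A = A) (X Y : 𝔤) :
    killingForm ℝ 𝔤 X Y = LinearMap.trace ℝ (Matrix N N ℝ)
      ((mulLR (X * Y : Matrix N N ℝ) 1 - mulLR X Y - mulLR Y X + mulLR 1 (Y * X : Matrix N N ℝ)) ∘ₗ
        𝔤.toSubmodule.subtype ∘ₗ p) := by
  set T : Matrix N N ℝ →ₗ[ℝ] Matrix N N ℝ :=
    mulLR (X * Y : Matrix N N ℝ) 1 - mulLR X Y - mulLR Y X + mulLR 1 (Y * X : Matrix N N ℝ) with hT
  have h : LieAlgebra.ad ℝ 𝔤 X ∘ₗ LieAlgebra.ad ℝ 𝔤 Y = p ∘ₗ (T ∘ₗ 𝔤.toSubmodule.subtype) := by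
    refine LinearMap.ext fun A => ?_
    have h1 : T (A : Matrix N N ℝ) = ((⁅X, ⁅Y, A⁆⁆ : 𝔤) : Matrix N N ℝ) := by
      simp only [hT, LinearMap.add_apply, LinearMap.sub_apply, mulLR_apply,
        LieSubalgebra.coe_bracket, Ring.lie_def]
      noncomm_ring
    show ⁅X, ⁅Y, A⁆⁆ = p (T (A : Matrix N N ℝ))
    rw [h1, hp]
  rw [LieModule.traceForm_apply_apply]
  show LinearMap.trace ℝ 𝔤 (LieAlgebra.ad ℝ 𝔤 X ∘ₗ LieAlgebra.ad ℝ 𝔤 Y) = _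
  rw [h]
  exact LinearMap.trace_comp_comm' _ _

end MatrixTraces

variable {n : ℕ}

theorem mem_slAlg {A : Matrix (Fin (n + 1)) (Fin (n + 1)) ℝ} : A ∈ slAlg n ↔ A.trace = 0 :=
  LinearMap.mem_ker

/-- The projection `A ↦ A - (tr A / (n+1)) 1` of `𝔤𝔩(n+1)` onto `𝔰𝔩(n+1)`. -/
noncomputable def slProj (n : ℕ) : Matrix (Fin (n + 1)) (Fin (n + 1)) ℝ →ₗ[ℝ] slAlg n :=
  LinearMap.codRestrict (slAlg n).toSubmodule
    (LinearMap.id - ((n + 1 : ℝ)⁻¹ • (Matrix.traceLinearMap (Fin (n + 1)) ℝ ℝ)).smulRight 1)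
    fun A => by
      show _ ∈ slAlg n
      rw [mem_slAlg]
      have : (n + 1 : ℝ) ≠ 0 := by positivity
      simp [Matrix.trace_sub, Matrix.trace_smul]
      field_simp
      simp

theorem coe_slProj (A : Matrix (Fin (n + 1)) (Fin (n + 1)) ℝ) :
    (slProj n A : Matrix (Fin (n + 1)) (Fin (n + 1)) ℝ) = A - ((n + 1 : ℝ)⁻¹ * A.trace) • 1 := rfl

/-- Scalar matrices do not contribute to the trace of `M ↦ [X, [Y, M]]`, so it may be taken over all
matrices. -/
theorem killingForm_slAlg (X Y : slAlg n) :
    killingForm ℝ (slAlg n) X Y =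
      2 * (n + 1) * (X * Y : Matrix (Fin (n + 1)) (Fin (n + 1)) ℝ).trace := by
  rw [killingForm_eq_trace (slAlg n) (slProj n)]
  swap
  · intro A
    ext1
    rw [coe_slProj, mem_slAlg.1 A.2]
    simp
  have h : (mulLR (X * Y : Matrix (Fin (n + 1)) (Fin (n + 1)) ℝ) 1 - mulLR X Y - mulLR Y X +
      mulLR 1 (Y * X : Matrix (Fin (n + 1)) (Fin (n + 1)) ℝ)) ∘ₗ
        (slAlg n).toSubmodule.subtype ∘ₗ slProj n =
      mulLR (X * Y : Matrix (Fin (n + 1)) (Fin (n + 1)) ℝ) 1 - mulLR X Y - mulLR Y X +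
        mulLR 1 (Y * X : Matrix (Fin (n + 1)) (Fin (n + 1)) ℝ) := by
    refine LinearMap.ext fun A => ?_
    simp only [LinearMap.comp_apply, Submodule.subtype_apply, LinearMap.add_apply,
      LinearMap.sub_apply, mulLR_apply]
    rw [coe_slProj]
    simp only [sub_mul, mul_sub, smul_mul_assoc, mul_smul_comm, one_mul, mul_one]
    abel
  rw [h]
  simp only [map_add, map_sub, trace_mulLR, mem_slAlg.1 X.2, mem_slAlg.1 Y.2, Matrix.trace_one,
    Matrix.trace_mul_comm (Y : Matrix (Fin (n + 1)) (Fin (n + 1)) ℝ) X]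
  simp
  ring

/-- The matrix of the split form. -/
local notation "J" => LieAlgebra.Orthogonal.JD (Fin (n + 1)) ℝ

theorem JD_mul_JD : J * J = 1 := by
  simp [LieAlgebra.Orthogonal.JD, Matrix.fromBlocks_multiply]

theorem JD_transpose : Jᵀ = J := by
  simp [LieAlgebra.Orthogonal.JD, Matrix.fromBlocks_transpose]

theorem mem_soAlg {A : Matrix (Idx n) (Idx n) ℝ} : A ∈ soAlg n ↔ Aᵀ * J = -(J * A) := by
  rw [soAlg, LieAlgebra.Orthogonal.typeD, mem_skewAdjointMatricesLieSubalgebra,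
    mem_skewAdjointMatricesSubmodule, Matrix.IsSkewAdjoint, Matrix.IsAdjointPair, mul_neg]

theorem JD_mul_transpose_mul_JD {A : Matrix (Idx n) (Idx n) ℝ} (hA : A ∈ soAlg n) :
    J * Aᵀ * J = -A := by
  rw [mul_assoc, mem_soAlg.1 hA, mul_neg, ← mul_assoc, JD_mul_JD, one_mul]

/-- The projection `A ↦ (A - J Aᵀ J) / 2` of `𝔤𝔩(2n+2)` onto `𝔰𝔬(n+1, n+1)`. -/
noncomputable def soProj : Matrix (Idx n) (Idx n) ℝ →ₗ[ℝ] soAlg n :=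
  LinearMap.codRestrict (soAlg n).toSubmodule
    ((2⁻¹ : ℝ) • (LinearMap.id - mulTransposeLR J J)) fun A => by
      show _ ∈ soAlg n
      rw [mem_soAlg]
      simp only [LinearMap.smul_apply, LinearMap.sub_apply, LinearMap.id_apply,
        mulTransposeLR_apply, Matrix.transpose_smul, Matrix.transpose_sub, Matrix.transpose_mul,
        Matrix.transpose_transpose, JD_transpose, sub_mul, mul_sub, smul_mul_assoc, mul_smul_comm,
        mul_assoc, JD_mul_JD, mul_one]
      rw [← mul_assoc J J, JD_mul_JD, one_mul, ← smul_neg, neg_sub]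

theorem coe_soProj (A : Matrix (Idx n) (Idx n) ℝ) :
    (soProj A : Matrix (Idx n) (Idx n) ℝ) = (2⁻¹ : ℝ) • (A - J * (Aᵀ * J)) := rfl

theorem trace_eq_zero_of_mem_soAlg {A : Matrix (Idx n) (Idx n) ℝ} (hA : A ∈ soAlg n) :
    A.trace = 0 := by
  have h := congrArg Matrix.trace (JD_mul_transpose_mul_JD hA)
  rw [Matrix.trace_mul_comm, ← mul_assoc, JD_mul_JD, one_mul, Matrix.trace_transpose,
    Matrix.trace_neg] at h
  linarith

/-- By `killingForm_eq_trace` with `soProj`, the Killing form is half the difference of the traces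
of `M ↦ [X, [Y, M]]` and `M ↦ [X, [Y, J Mᵀ J]]` over all matrices. -/
theorem killingForm_soAlg (X Y : soAlg n) :
    killingForm ℝ (soAlg n) X Y = 2 * n * (X * Y : Matrix (Idx n) (Idx n) ℝ).trace := by
  rw [killingForm_eq_trace (soAlg n) (soProj)]
  swap
  · intro A
    ext1
    rw [coe_soProj, ← mul_assoc, JD_mul_transpose_mul_JD A.2, sub_neg_eq_add, ← two_smul ℝ,
      smul_smul]
    norm_num
  obtain ⟨X, hX⟩ := X
  obtain ⟨Y, hY⟩ := Y
  dsimp only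
  have h : (mulLR (X * Y) 1 - mulLR X Y - mulLR Y X + mulLR 1 (Y * X)) ∘ₗ
        (soAlg n).toSubmodule.subtype ∘ₗ soProj =
      (2⁻¹ : ℝ) • ((mulLR (X * Y) 1 - mulLR X Y - mulLR Y X + mulLR 1 (Y * X)) -
        (mulTransposeLR (X * Y * J) J - mulTransposeLR (X * J) (J * Y) -
          mulTransposeLR (Y * J) (J * X) + mulTransposeLR J (J * (Y * X)))) := by
    refine LinearMap.ext fun A => ?_
    simp only [LinearMap.comp_apply, Submodule.subtype_apply, LinearMap.add_apply,
      LinearMap.sub_apply, LinearMap.smul_apply, mulLR_apply, mulTransposeLR_apply]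
    rw [coe_soProj]
    simp only [sub_mul, mul_sub, smul_mul_assoc, mul_smul_comm, one_mul, mul_one, smul_sub,
      smul_add, mul_assoc]
    abel
  have e1 : ((X * Y * J)ᵀ * J).trace = (X * Y).trace := by
    rw [← Matrix.trace_transpose, Matrix.transpose_mul, Matrix.transpose_transpose, JD_transpose,
      Matrix.trace_mul_comm, mul_assoc, JD_mul_JD, mul_one]
  have e2 : ∀ A ∈ soAlg n, ∀ B : Matrix (Idx n) (Idx n) ℝ,
      ((A * J)ᵀ * (J * B)).trace = -(A * B).trace := by
    intro A hA B
    rw [Matrix.transpose_mul, JD_transpose, ← mul_assoc, JD_mul_transpose_mul_JD hA, neg_mul,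
      Matrix.trace_neg]
  have e3 : (Jᵀ * (J * (Y * X))).trace = (X * Y).trace := by
    rw [JD_transpose, ← mul_assoc, JD_mul_JD, one_mul, Matrix.trace_mul_comm]
  rw [h]
  simp only [map_smul, map_add, map_sub, trace_mulLR, trace_mulTransposeLR, e1, e2 X hX, e2 Y hY,
    e3, trace_eq_zero_of_mem_soAlg hX, trace_eq_zero_of_mem_soAlg hY, Matrix.trace_one,
    Matrix.trace_mul_comm Y X]
  simp
  ring

theorem transpose_mem_soAlg {A : Matrix (Idx n) (Idx n) ℝ} (hA : A ∈ soAlg n) :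
    Aᵀ ∈ soAlg n := by
  rw [mem_soAlg, Matrix.transpose_transpose]
  calc A * J = -((J * Aᵀ * J) * J) := by rw [JD_mul_transpose_mul_JD hA, neg_mul, neg_neg]
    _ = -(J * Aᵀ) := by rw [mul_assoc, JD_mul_JD, mul_one]

/-- The Killing form of `𝔰𝔬(n+1, n+1)` is nondegenerate: `𝔰𝔬(n+1, n+1)` is closed under
transposition, and `tr (A Aᵀ) > 0` for `A ≠ 0`. -/
theorem eq_zero_of_killingForm_soAlg (hn : n ≠ 0) (A : soAlg n)
    (hA : ∀ B, killingForm ℝ (soAlg n) A B = 0) : A = 0 := by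
  have h := hA ⟨_, transpose_mem_soAlg A.2⟩
  rw [killingForm_soAlg, mul_eq_zero, or_iff_right (by positivity)] at h
  ext1
  simpa [← Matrix.conjTranspose_eq_transpose_of_trivial,
    Matrix.trace_mul_conjTranspose_self_eq_zero_iff] using h

end ProjConf

/-! ### The exterior derivative of 1-forms -/

namespace ProjConf

section VectorSpace

variable {E E' : Type*} [NormedAddCommGroup E] [NormedSpace ℝ E]
  [NormedAddCommGroup E'] [NormedSpace ℝ E']

/-- The derivative of the pullback by `g` of a 1-form `b` on a vector space, applied to a fixed
vector `η`. -/
theorem fderiv_pullback_apply {b : E' × E' → ℝ} {g : E → E'} {p : E} (ξ η : E)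
    (hg : ContDiffAt ℝ 2 g p) (hlin : IsLinearMap ℝ fun v => b (g p, v))
    (hb : DifferentiableAt ℝ b (g p, fderiv ℝ g p η)) :
    fderiv ℝ (fun y => b (g y, fderiv ℝ g y η)) p ξ =
      fderiv ℝ (fun q => b (q, fderiv ℝ g p η)) (g p) (fderiv ℝ g p ξ) +
        b (g p, fderiv ℝ (fderiv ℝ g) p ξ η) := by
  have hg1 : DifferentiableAt ℝ g p := hg.differentiableAt (by norm_num)
  have hg2 : DifferentiableAt ℝ (fderiv ℝ g) p :=
    (hg.fderiv_right (m := 1) (by norm_num)).differentiableAt (by norm_num)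
  have hd : HasFDerivAt (fun y => (g y, fderiv ℝ g y η))
      ((fderiv ℝ g p).prod ((fderiv ℝ (fderiv ℝ g) p).flip η)) p :=
    by
    refine hg1.hasFDerivAt.prodMk ?_
    convert! hg2.hasFDerivAt.clm_apply (hasFDerivAt_const η p) using 1
    ext
    simp
  have h1 := (hb.hasFDerivAt.comp p hd).fderiv
  have h2 : HasFDerivAt (fun q => b (q, fderiv ℝ g p η)) _ (g p) :=
    hb.hasFDerivAt.comp (g p) (hasFDerivAt_prodMk_left (g p) (fderiv ℝ g p η))
  have h3 : HasFDerivAt (fun v => b (g p, v)) _ (fderiv ℝ g p η) :=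
    hb.hasFDerivAt.comp (fderiv ℝ g p η) (hasFDerivAt_prodMk_right (g p) (fderiv ℝ g p η))
  -- a linear functional that is differentiable somewhere is its own derivative
  have h4 : ∀ w, fderiv ℝ b (g p, fderiv ℝ g p η) (0, w) = b (g p, w) := by
    intro w
    have h5 : HasDerivAt (fun t : ℝ => b (g p, fderiv ℝ g p η + t • w))
        (fderiv ℝ b (g p, fderiv ℝ g p η) (0, w)) 0 := by
      have h6 : HasDerivAt (fun t : ℝ => fderiv ℝ g p η + t • w) w 0 := by
        simpa using ((hasDerivAt_id (0 : ℝ)).smul_const w).const_add (fderiv ℝ g p η)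
      have h7 : HasFDerivAt (fun v => b (g p, v))
          (fderiv ℝ b (g p, fderiv ℝ g p η) ∘L ContinuousLinearMap.inr ℝ E' E')
          (fderiv ℝ g p η + (0 : ℝ) • w) := by simpa using h3
      have h8 := h7.comp_hasDerivAt (0 : ℝ) h6
      simp only [ContinuousLinearMap.comp_apply, ContinuousLinearMap.inr_apply] at h8
      exact h8
    have h8 : (fun t : ℝ => b (g p, fderiv ℝ g p η + t • w)) =
        fun t => b (g p, fderiv ℝ g p η) + t * b (g p, w) := by
      funext t
      rw [hlin.map_add, hlin.map_smul, smul_eq_mul]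
    rw [h8] at h5
    have h9 : HasDerivAt (fun t : ℝ => b (g p, fderiv ℝ g p η) + t * b (g p, w))
        (b (g p, w)) 0 := by
      simpa using ((hasDerivAt_id (0 : ℝ)).mul_const (b (g p, w))).const_add
        (b (g p, fderiv ℝ g p η))
    exact h5.unique h9
  rw [show (fun y => b (g y, fderiv ℝ g y η)) = b ∘ fun y => (g y, fderiv ℝ g y η) from rfl, h1,
    h2.fderiv, ← h4]
  simp only [ContinuousLinearMap.comp_apply, ContinuousLinearMap.prod_apply,
    ContinuousLinearMap.flip_apply, ContinuousLinearMap.inl_apply]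
  rw [← map_add]
  simp

/-- Pullback commutes with the exterior derivative, on a vector space. -/
theorem fderiv_pullback_sub {b : E' × E' → ℝ} {g : E → E'} {p : E} (ξ η : E)
    (hg : ContDiffAt ℝ 2 g p) (hlin : IsLinearMap ℝ fun v => b (g p, v))
    (hb : ∀ v, DifferentiableAt ℝ b (g p, v)) :
    fderiv ℝ (fun y => b (g y, fderiv ℝ g y η)) p ξ -
        fderiv ℝ (fun y => b (g y, fderiv ℝ g y ξ)) p η =
      fderiv ℝ (fun q => b (q, fderiv ℝ g p η)) (g p) (fderiv ℝ g p ξ) -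
        fderiv ℝ (fun q => b (q, fderiv ℝ g p ξ)) (g p) (fderiv ℝ g p η) := by
  have hs : IsSymmSndFDerivAt ℝ g p := hg.isSymmSndFDerivAt (by simp)
  rw [fderiv_pullback_apply ξ η hg hlin (hb _), fderiv_pullback_apply η ξ hg hlin (hb _), hs ξ η]
  ring

end VectorSpace

section Forms

variable {E : Type*} [NormedAddCommGroup E] [NormedSpace ℝ E]
  {M : Type*} [TopologicalSpace M] [ChartedSpace E M]
  {E' : Type*} [NormedAddCommGroup E'] [NormedSpace ℝ E']
  {M' : Type*} [TopologicalSpace M'] [ChartedSpace E' M']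

/-- A 1-form in the preferred chart at `x`, as a function of a point and a vector. -/
noncomputable def chartForm (α : ∀ x : M, TangentSpace 𝓘(ℝ, E) x → ℝ) (x : M) (p : E × E) : ℝ :=
  α ((extChartAt 𝓘(ℝ, E) x).symm p.1)
    (mfderiv 𝓘(ℝ, E) 𝓘(ℝ, E) (extChartAt 𝓘(ℝ, E) x).symm p.1 p.2)

theorem extDer_eq_chartForm (α : ∀ x : M, TangentSpace 𝓘(ℝ, E) x → ℝ) (x : M) (ξ η : E) :
    extDer α x ξ η = fderiv ℝ (fun y => chartForm α x (y, η)) (extChartAt 𝓘(ℝ, E) x x) ξ -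
      fderiv ℝ (fun y => chartForm α x (y, ξ)) (extChartAt 𝓘(ℝ, E) x x) η := rfl

theorem extDer_swap (α : ∀ x : M, TangentSpace 𝓘(ℝ, E) x → ℝ) (x : M)
    (ξ η : TangentSpace 𝓘(ℝ, E) x) : extDer α x ξ η = -extDer α x η ξ :=
  (neg_sub _ _).symm

variable [IsManifold 𝓘(ℝ, E) ∞ M] [IsManifold 𝓘(ℝ, E') ∞ M']

/-- A smooth real 1-form on a manifold. Smoothness is that of the function on the total space of
the tangent bundle. -/
structure IsSmoothOneForm (α : ∀ x : M, TangentSpace 𝓘(ℝ, E) x → ℝ) : Prop where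
  linear : ∀ x, IsLinearMap ℝ (α x)
  smooth : ContMDiff 𝓘(ℝ, E).tangent 𝓘(ℝ, ℝ) ∞ fun v : TangentBundle 𝓘(ℝ, E) M => α v.1 v.2

theorem contMDiffAt_extChartAt_symm {x : M} {y : E} (hy : y ∈ (extChartAt 𝓘(ℝ, E) x).target) :
    ContMDiffAt 𝓘(ℝ, E) 𝓘(ℝ, E) ∞ (extChartAt 𝓘(ℝ, E) x).symm y :=
  (contMDiffOn_extChartAt_symm x).contMDiffAt ((isOpen_extChartAt_target x).mem_nhds hy)

/-- In the total space of the tangent bundle, the preferred chart at `x` lifts to a smooth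
parametrisation `(y, v) ↦ T_y(φ⁻¹) v`. -/
theorem contMDiffAt_tangent_extChartAt_symm (x : M) (v : E) :
    ContMDiffAt (𝓘(ℝ, E × E)) 𝓘(ℝ, E).tangent ∞
      (fun p : E × E => (⟨(extChartAt 𝓘(ℝ, E) x).symm p.1,
        mfderiv 𝓘(ℝ, E) 𝓘(ℝ, E) (extChartAt 𝓘(ℝ, E) x).symm p.1 p.2⟩ :
          TangentBundle 𝓘(ℝ, E) M)) (extChartAt 𝓘(ℝ, E) x x, v) := by
  have : IsManifold 𝓘(ℝ, E) 1 M := .of_le (n := ∞) (by simp)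
  have hfst : ContMDiffAt 𝓘(ℝ, E × E) 𝓘(ℝ, E) ∞ (Prod.fst : E × E → E)
      (extChartAt 𝓘(ℝ, E) x x, v) := contDiff_fst.contMDiff.contMDiffAt
  have hsnd : ContMDiffAt 𝓘(ℝ, E × E) 𝓘(ℝ, E) ∞ (Prod.snd : E × E → E)
      (extChartAt 𝓘(ℝ, E) x x, v) := contDiff_snd.contMDiff.contMDiffAt
  rw [Bundle.contMDiffAt_totalSpace]
  refine ⟨ContMDiffAt.comp (g := (extChartAt 𝓘(ℝ, E) x).symm) (extChartAt 𝓘(ℝ, E) x x, v)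
    (contMDiffAt_extChartAt_symm (mem_extChartAt_target x)) hfst, ?_⟩
  refine hsnd.congr_of_eventuallyEq ?_
  have hmem : ∀ᶠ p : E × E in nhds (extChartAt 𝓘(ℝ, E) x x, v),
      p.1 ∈ (extChartAt 𝓘(ℝ, E) x).target :=
    continuousAt_fst.eventually ((isOpen_extChartAt_target x).mem_nhds (mem_extChartAt_target x))
  filter_upwards [hmem] with p hp
  have hsrc : (extChartAt 𝓘(ℝ, E) x).symm p.1 ∈ (chartAt E x).source := by
    rw [← extChartAt_source 𝓘(ℝ, E)]
    exact (extChartAt 𝓘(ℝ, E) x).map_target hp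
  have h1 := mfderiv_extChartAt_comp_mfderivWithin_extChartAt_symm (I := 𝓘(ℝ, E)) hp
  rw [← TangentBundle.continuousLinearMapAt_trivializationAt hsrc] at h1
  have h2 := congrArg (fun L => L p.2) h1
  simp only [modelWithCornersSelf_coe, Set.range_id, mfderivWithin_univ] at h2
  rw [extChartAt_to_inv (I := 𝓘(ℝ, E)) x]
  refine Eq.trans ?_ h2
  symm
  exact congrFun (Bundle.Trivialization.coe_linearMapAt_of_mem _ hsrc) _

theorem IsSmoothOneForm.contDiffAt_chartForm {α : ∀ x : M, TangentSpace 𝓘(ℝ, E) x → ℝ}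
    (hα : IsSmoothOneForm α) (x : M) (v : E) :
    ContDiffAt ℝ ∞ (chartForm α x) (extChartAt 𝓘(ℝ, E) x x, v) :=
  (hα.smooth.contMDiffAt.comp _ (contMDiffAt_tangent_extChartAt_symm x v)).contDiffAt

theorem IsSmoothOneForm.isLinearMap_chartForm {α : ∀ x : M, TangentSpace 𝓘(ℝ, E) x → ℝ}
    (hα : IsSmoothOneForm α) (x : M) (y : E) :
    IsLinearMap ℝ fun v => chartForm α x (y, v) where
  map_add v w :=
    (congrArg (α _) (ContinuousLinearMap.map_add _ v w)).trans ((hα.linear _).map_add _ _)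
  map_smul c v :=
    (congrArg (α _) (ContinuousLinearMap.map_smul _ c v)).trans ((hα.linear _).map_smul _ _)

theorem IsSmoothOneForm.differentiableAt_chartForm {α : ∀ x : M, TangentSpace 𝓘(ℝ, E) x → ℝ}
    (hα : IsSmoothOneForm α) (x : M) (v : E) :
    DifferentiableAt ℝ (fun y => chartForm α x (y, v)) (extChartAt 𝓘(ℝ, E) x x) :=
  DifferentiableAt.comp (g := chartForm α x) (f := fun y => (y, v)) (extChartAt 𝓘(ℝ, E) x x)
    ((hα.contDiffAt_chartForm x v).differentiableAt (by simp))
    (hasFDerivAt_prodMk_left _ v).differentiableAt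

theorem IsSmoothOneForm.extDer_add_left {α : ∀ x : M, TangentSpace 𝓘(ℝ, E) x → ℝ}
    (hα : IsSmoothOneForm α) (x : M) (ξ ξ' η : E) :
    extDer α x (ξ + ξ' : E) η = extDer α x ξ η + extDer α x ξ' η := by
  simp only [extDer_eq_chartForm]
  have h : (fun y => chartForm α x (y, ξ + ξ')) =
      fun y => chartForm α x (y, ξ) + chartForm α x (y, ξ') :=
    funext fun y => (hα.isLinearMap_chartForm x y).map_add ξ ξ'
  have h2 : fderiv ℝ (fun y => chartForm α x (y, ξ + ξ')) (extChartAt 𝓘(ℝ, E) x x) =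
      fderiv ℝ (fun y => chartForm α x (y, ξ)) (extChartAt 𝓘(ℝ, E) x x) +
        fderiv ℝ (fun y => chartForm α x (y, ξ')) (extChartAt 𝓘(ℝ, E) x x) := by
    rw [h]
    exact fderiv_fun_add (hα.differentiableAt_chartForm x ξ) (hα.differentiableAt_chartForm x ξ')
  rw [h2, map_add]
  simp only [add_apply]
  ring

theorem IsSmoothOneForm.extDer_smul_left {α : ∀ x : M, TangentSpace 𝓘(ℝ, E) x → ℝ}
    (hα : IsSmoothOneForm α) (x : M) (c : ℝ) (ξ η : E) :
    extDer α x (c • ξ : E) η = c * extDer α x ξ η := by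
  simp only [extDer_eq_chartForm]
  have h : (fun y => chartForm α x (y, c • ξ)) = fun y => c • chartForm α x (y, ξ) :=
    funext fun y => (hα.isLinearMap_chartForm x y).map_smul c ξ
  have h2 : fderiv ℝ (fun y => chartForm α x (y, c • ξ)) (extChartAt 𝓘(ℝ, E) x x) =
      c • fderiv ℝ (fun y => chartForm α x (y, ξ)) (extChartAt 𝓘(ℝ, E) x x) := by
    rw [h]
    exact fderiv_fun_const_smul (hα.differentiableAt_chartForm x ξ) c
  rw [h2, map_smul]
  simp only [smul_apply, smul_eq_mul]
  ring

/-- The chart representation of a `C²` map is `C²`. -/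
theorem contDiffAt_writtenInExtChartAt {f : M → M'} {x : M}
    (hf : ContMDiffAt 𝓘(ℝ, E) 𝓘(ℝ, E') 2 f x) :
    ContDiffAt ℝ 2 (writtenInExtChartAt 𝓘(ℝ, E) 𝓘(ℝ, E') x f) (extChartAt 𝓘(ℝ, E) x x) := by
  have two_le : (2 : WithTop ℕ∞) ≤ ∞ := WithTop.coe_le_coe.2 le_top
  have i2' : IsManifold 𝓘(ℝ, E') 2 M' := .of_le (n := ∞) two_le
  have hx : (extChartAt 𝓘(ℝ, E) x).symm (extChartAt 𝓘(ℝ, E) x x) = x := extChartAt_to_inv x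
  have hf' : ContMDiffAt 𝓘(ℝ, E) 𝓘(ℝ, E') 2 f
    ((extChartAt 𝓘(ℝ, E) x).symm (extChartAt 𝓘(ℝ, E) x x)) := by rwa [hx]
  refine ContMDiffAt.contDiffAt (ContMDiffAt.comp (extChartAt 𝓘(ℝ, E) x x) ?_ (hf'.comp _
    ((contMDiffAt_extChartAt_symm (mem_extChartAt_target x)).of_le two_le)))
  simp only [Function.comp_apply, hx]
  exact contMDiffAt_extChartAt

/-- In charts, the pullback of `β` by `f` is the pullback of the chart representation of `β` by
the chart representation of `f`. -/
theorem eventually_chartForm_pullback (β : ∀ x : M', TangentSpace 𝓘(ℝ, E') x → ℝ) {f : M → M'}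
    {x : M} (hf : ContMDiffAt 𝓘(ℝ, E) 𝓘(ℝ, E') 2 f x) :
    ∀ᶠ y in nhds (extChartAt 𝓘(ℝ, E) x x), ∀ v : E,
      chartForm (fun z v => β (f z) (mfderiv 𝓘(ℝ, E) 𝓘(ℝ, E') f z v)) x (y, v) =
        chartForm β (f x) (writtenInExtChartAt 𝓘(ℝ, E) 𝓘(ℝ, E') x f y,
          fderiv ℝ (writtenInExtChartAt 𝓘(ℝ, E) 𝓘(ℝ, E') x f) y v) := by
  have two_le : (2 : WithTop ℕ∞) ≤ ∞ := WithTop.coe_le_coe.2 le_top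
  have i2 : IsManifold 𝓘(ℝ, E) 2 M := .of_le (n := ∞) two_le
  have i2' : IsManifold 𝓘(ℝ, E') 2 M' := .of_le (n := ∞) two_le
  have hcongr : ∀ a b : M', a = b → ∀ v w : E', v = w → β a v = β b w := by
    rintro a _ rfl v _ rfl
    rfl
  have hgc := contDiffAt_writtenInExtChartAt hf
  set g : E → E' := writtenInExtChartAt 𝓘(ℝ, E) 𝓘(ℝ, E') x f with hg
  set φ := extChartAt 𝓘(ℝ, E) x with hφ
  set ψ := extChartAt 𝓘(ℝ, E') (f x) with hψ
  have hx : φ.symm (φ x) = x := extChartAt_to_inv x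
  have hf' : ContMDiffAt 𝓘(ℝ, E) 𝓘(ℝ, E') 2 f (φ.symm (φ x)) := by rwa [hx]
  have hsymm : ContMDiffAt 𝓘(ℝ, E) 𝓘(ℝ, E) 2 φ.symm (φ x) :=
    (contMDiffAt_extChartAt_symm (mem_extChartAt_target x)).of_le two_le
  have e1 : ∀ᶠ y in nhds (φ x), ContMDiffAt 𝓘(ℝ, E) 𝓘(ℝ, E') 2 f (φ.symm y) :=
    hsymm.continuousAt.eventually ((contMDiffAt_iff_contMDiffAt_nhds (by simp)).1 hf')
  have e2 : ∀ᶠ y in nhds (φ x), y ∈ φ.target :=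
    (isOpen_extChartAt_target x).mem_nhds (mem_extChartAt_target x)
  have e3 : ∀ᶠ y in nhds (φ x), f (φ.symm y) ∈ ψ.source := by
    refine (hf'.comp _ hsymm).continuousAt.eventually
      ((isOpen_extChartAt_source (f x)).mem_nhds ?_)
    simp only [Function.comp_apply, hx]
    exact mem_extChartAt_source (f x)
  have e4 : ∀ᶠ y in nhds (φ x), ContDiffAt ℝ 2 g y := hgc.eventually (by norm_num)
  filter_upwards [e1, e2, e3, e4] with y h1 h2 h3 h4 v
  have hinv : ψ.symm (g y) = f (φ.symm y) := ψ.left_inv h3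
  have d1 : MDifferentiableAt 𝓘(ℝ, E) 𝓘(ℝ, E) φ.symm y :=
    (contMDiffAt_extChartAt_symm h2).mdifferentiableAt (by simp)
  have d2 : MDifferentiableAt 𝓘(ℝ, E) 𝓘(ℝ, E') f (φ.symm y) := h1.mdifferentiableAt (by norm_num)
  have d3 : MDifferentiableAt 𝓘(ℝ, E) 𝓘(ℝ, E') g y :=
    (h4.differentiableAt (by norm_num)).mdifferentiableAt
  have d4 : MDifferentiableAt 𝓘(ℝ, E') 𝓘(ℝ, E') ψ.symm (g y) :=
    (contMDiffAt_extChartAt_symm (ψ.map_source h3)).mdifferentiableAt (by simp)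
  have heq : (ψ.symm ∘ g) =ᶠ[nhds y] f ∘ φ.symm := by
    have : ∀ᶠ z in nhds y, f (φ.symm z) ∈ ψ.source :=
      (h1.continuousAt.comp (f := φ.symm)
        (contMDiffAt_extChartAt_symm h2).continuousAt).eventually
          ((isOpen_extChartAt_source (f x)).mem_nhds h3)
    filter_upwards [this] with z hz
    exact ψ.left_inv hz
  have hder : mfderiv 𝓘(ℝ, E') 𝓘(ℝ, E') ψ.symm (g y) (fderiv ℝ g y v) =
      mfderiv 𝓘(ℝ, E) 𝓘(ℝ, E') f (φ.symm y) (mfderiv 𝓘(ℝ, E) 𝓘(ℝ, E) φ.symm y v) := by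
    have c1 := mfderiv_comp y d4 d3
    have c2 := mfderiv_comp y d2 d1
    rw [heq.mfderiv_eq] at c1
    have c3 := congrArg (fun L => L v) (c1.symm.trans c2)
    rw [mfderiv_eq_fderiv] at c3
    exact c3
  simp only [chartForm]
  rw [← hψ, ← hφ]
  exact (hcongr _ _ hinv _ _ hder).symm

theorem IsSmoothOneForm.differentiableAt_chartForm_pullback
    {β : ∀ x : M', TangentSpace 𝓘(ℝ, E') x → ℝ} (hβ : IsSmoothOneForm β) {f : M → M'} {x : M}
    (hf : ContMDiffAt 𝓘(ℝ, E) 𝓘(ℝ, E') 2 f x) (v : E) :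
    DifferentiableAt ℝ (fun y => chartForm
      (fun z v => β (f z) (mfderiv 𝓘(ℝ, E) 𝓘(ℝ, E') f z v)) x (y, v)) (extChartAt 𝓘(ℝ, E) x x) := by
  have hgc := contDiffAt_writtenInExtChartAt hf
  have hgx : writtenInExtChartAt 𝓘(ℝ, E) 𝓘(ℝ, E') x f (extChartAt 𝓘(ℝ, E) x x) =
      extChartAt 𝓘(ℝ, E') (f x) (f x) := by simp [writtenInExtChartAt]
  have hd := (hgc.differentiableAt (by norm_num)).prodMk
    (((hgc.fderiv_right (m := 1) (by norm_num)).differentiableAt (by norm_num)).clm_apply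
      (differentiableAt_const v))
  refine DifferentiableAt.congr_of_eventuallyEq
    (DifferentiableAt.comp (g := chartForm β (f x)) _ ?_ hd)
    ((eventually_chartForm_pullback β hf).mono fun y hy => hy v)
  rw [hgx]
  exact (hβ.contDiffAt_chartForm (f x) _).differentiableAt (by simp)

/-- The exterior derivative is natural: `f^*(dβ) = d(f^*β)`. -/
theorem IsSmoothOneForm.extDer_pullback {β : ∀ x : M', TangentSpace 𝓘(ℝ, E') x → ℝ}
    (hβ : IsSmoothOneForm β) {f : M → M'} {x : M} (hf : ContMDiffAt 𝓘(ℝ, E) 𝓘(ℝ, E') 2 f x)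
    (ξ η : TangentSpace 𝓘(ℝ, E) x) :
    extDer (fun z v => β (f z) (mfderiv 𝓘(ℝ, E) 𝓘(ℝ, E') f z v)) x ξ η =
      extDer β (f x) (mfderiv 𝓘(ℝ, E) 𝓘(ℝ, E') f x ξ) (mfderiv 𝓘(ℝ, E) 𝓘(ℝ, E') f x η) := by
  set g : E → E' := writtenInExtChartAt 𝓘(ℝ, E) 𝓘(ℝ, E') x f with hg
  have hgx : g (extChartAt 𝓘(ℝ, E) x x) = extChartAt 𝓘(ℝ, E') (f x) (f x) := by
    simp [hg, writtenInExtChartAt]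
  have hmf : mfderiv 𝓘(ℝ, E) 𝓘(ℝ, E') f x = fderiv ℝ g (extChartAt 𝓘(ℝ, E) x x) := by
    refine (hf.mdifferentiableAt (by norm_num)).mfderiv.trans ?_
    rw [modelWithCornersSelf_coe, Set.range_id, fderivWithin_univ]
  have hev : ∀ v : E, (fun y => chartForm
      (fun z v => β (f z) (mfderiv 𝓘(ℝ, E) 𝓘(ℝ, E') f z v)) x (y, v))
        =ᶠ[nhds (extChartAt 𝓘(ℝ, E) x x)] fun y => chartForm β (f x) (g y, fderiv ℝ g y v) :=
    fun v => (eventually_chartForm_pullback β hf).mono fun y hy => hy v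
  have key := fderiv_pullback_sub (b := chartForm β (f x)) (g := g) (ξ : E) (η : E)
    (contDiffAt_writtenInExtChartAt hf) (hβ.isLinearMap_chartForm (f x) _)
    (fun v => by rw [hgx]; exact (hβ.contDiffAt_chartForm (f x) v).differentiableAt (by simp))
  rw [hgx] at key
  rw [← (hev ξ).fderiv_eq, ← (hev η).fderiv_eq, ← hmf] at key
  exact key

end Forms

section VectorSpace

variable {V : Type*} [NormedAddCommGroup V] [NormedSpace ℝ V]

theorem chartForm_vectorSpace (a : ∀ x : V, TangentSpace 𝓘(ℝ, V) x → ℝ) (p : V) (q : V × V) :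
    chartForm a p q = a q.1 q.2 := by
  have h : ∀ g : V → V, g = id → a (g q.1) (mfderiv 𝓘(ℝ, V) 𝓘(ℝ, V) g q.1 q.2) = a q.1 q.2 := by
    rintro _ rfl
    exact congrArg (a q.1) (congrArg (fun L => L q.2) (mfderiv_id (I := 𝓘(ℝ, V)) (x := q.1)))
  exact h _ (by rw [extChartAt_model_space_eq_id]; rfl)

end VectorSpace

end ProjConf

/-! ### The curvature of a Cartan connection -/

namespace ProjConf

namespace CartanConnection

variable {N : Type*} [Fintype N] [DecidableEq N]
  {EH : Type*} [NormedAddCommGroup EH] [NormedSpace ℝ EH]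
  {H : Type*} [TopologicalSpace H] [ChartedSpace EH H] [Group H]
  {E : Type*} [NormedAddCommGroup E] [NormedSpace ℝ E]
  {𝒢 : Type*} [TopologicalSpace 𝒢] [ChartedSpace E 𝒢] [IsManifold 𝓘(ℝ, E) ∞ 𝒢]
  {𝔤 : LieSubalgebra ℝ (Matrix N N ℝ)} {ρ : H →* Matrix N N ℝ} {act : 𝒢 → H → 𝒢}
  (conn : CartanConnection EH E 𝔤 ρ act)

/-- The matrix entries of a Cartan connection, as real 1-forms. -/
noncomputable def entry (i j : N) (x : 𝒢) (v : TangentSpace 𝓘(ℝ, E) x) : ℝ :=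
  (conn.form x v : Matrix N N ℝ) i j

theorem isSmoothOneForm_entry (i j : N) : IsSmoothOneForm (conn.entry i j) where
  linear x :=
    { map_add := fun v w => by simp [entry]
      map_smul := fun c v => by simp [entry] }
  smooth := conn.smooth i j

theorem curv_apply (u : 𝒢) (ξ η : TangentSpace 𝓘(ℝ, E) u) (i j : N) :
    conn.curv u ξ η i j = extDer (conn.entry i j) u ξ η +
      ⁅(conn.form u ξ : Matrix N N ℝ), (conn.form u η : Matrix N N ℝ)⁆ i j := rfl

theorem curvFun_swap (u : 𝒢) (X Y : 𝔤) : conn.curvFun u X Y = -conn.curvFun u Y X := by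
  ext i j
  rw [Matrix.neg_apply, curvFun, curvFun, curv_apply, curv_apply, extDer_swap, ← lie_skew,
    Matrix.neg_apply]
  ring

theorem curvFun_add_left (u : 𝒢) (X X' Y : 𝔤) :
    conn.curvFun u (X + X') Y = conn.curvFun u X Y + conn.curvFun u X' Y := by
  ext i j
  rw [Matrix.add_apply, curvFun, curvFun, curvFun, curv_apply, curv_apply, curv_apply]
  rw [map_add, map_add, AddMemClass.coe_add, add_lie, Matrix.add_apply]
  have h := (conn.isSmoothOneForm_entry i j).extDer_add_left u ((conn.form u).symm X)
    ((conn.form u).symm X') ((conn.form u).symm Y)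
  refine (congrArg (· + _) h).trans ?_
  ring

theorem curvFun_smul_left (u : 𝒢) (c : ℝ) (X Y : 𝔤) :
    conn.curvFun u (c • X) Y = c • conn.curvFun u X Y := by
  ext i j
  rw [Matrix.smul_apply, curvFun, curvFun, curv_apply, curv_apply]
  rw [map_smul, map_smul, SetLike.val_smul, smul_lie, Matrix.smul_apply]
  have h := (conn.isSmoothOneForm_entry i j).extDer_smul_left u c ((conn.form u).symm X)
    ((conn.form u).symm Y)
  refine (congrArg (· + _) h).trans ?_
  simp only [smul_eq_mul]
  ring

/-- The curvature function at a point as a bilinear map. -/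
noncomputable def curvBilin (u : 𝒢) : 𝔤 →ₗ[ℝ] 𝔤 →ₗ[ℝ] Matrix N N ℝ :=
  LinearMap.mk₂ ℝ (conn.curvFun u) (conn.curvFun_add_left u) (conn.curvFun_smul_left u)
    (fun X Y Y' => by
      rw [curvFun_swap, curvFun_add_left, neg_add, ← curvFun_swap, ← curvFun_swap])
    (fun c X Y => by rw [curvFun_swap, curvFun_smul_left, ← smul_neg, ← curvFun_swap])

theorem curvBilin_apply (u : 𝒢) (X Y : 𝔤) : conn.curvBilin u X Y = conn.curvFun u X Y := rfl

theorem form_congr {x y : 𝒢} (h : x = y) {v w : E} (hvw : v = w) :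
    (conn.form x (v : E) : Matrix N N ℝ) = conn.form y (w : E) := by
  subst h hvw
  rfl

theorem form_fundamental {h : H} (hh : h = 1) (x : 𝒢) (ζ : EH) :
    (conn.form (act x h) (mfderiv 𝓘(ℝ, EH) 𝓘(ℝ, E) (fun k => act x k) h ζ) : Matrix N N ℝ) =
      dRep ρ (ζ : TangentSpace 𝓘(ℝ, EH) (1 : H)) := by
  subst hh
  exact conn.fundamental x ζ

/-- The curvature is horizontal: it vanishes on generators of the action of `H`. This is the
infinitesimal form of the equivariance, obtained by pulling the connection back along
`(x, h) ↦ x h`, in charts at `u` and `1`. -/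
theorem curvFun_eq_zero_of_eq_dRep [IsManifold 𝓘(ℝ, EH) ∞ H]
    (hact : IsSmoothRightAction EH E act)
    (hρ : ∀ i j, ContMDiff 𝓘(ℝ, EH) 𝓘(ℝ, ℝ) ∞ fun h : H => ρ h i j)
    (u : 𝒢) (ζ : EH) (X Y : 𝔤)
    (hY : (Y : Matrix N N ℝ) = dRep ρ (ζ : TangentSpace 𝓘(ℝ, EH) (1 : H))) :
    conn.curvFun u X Y = 0 := by
  have two_le : (2 : WithTop ℕ∞) ≤ ∞ := WithTop.coe_le_coe.2 le_top
  set φ := extChartAt 𝓘(ℝ, E) u with hφ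
  set ψ := extChartAt 𝓘(ℝ, EH) (1 : H) with hψ
  have hφu : φ.symm (φ u) = u := extChartAt_to_inv u
  have hψ1 : ψ.symm (ψ 1) = 1 := extChartAt_to_inv (1 : H)
  set F : E × EH → 𝒢 := fun z => act (φ.symm z.1) (ψ.symm z.2) with hF
  set p : E × EH := (φ u, ψ 1) with hp
  set v : E := (conn.form u).symm X with hv
  have hFp : F p = u := by simp only [hF, hp, hφu, hψ1, hact.act_one]
  have hsm : ∀ z : E × EH, z.1 ∈ φ.target → z.2 ∈ ψ.target →
      ContMDiffAt 𝓘(ℝ, E × EH) 𝓘(ℝ, E) ∞ F z := by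
    intro z h1 h2
    have hfst : ContMDiffAt 𝓘(ℝ, E × EH) 𝓘(ℝ, E) ∞ (Prod.fst : E × EH → E) z :=
      contDiff_fst.contMDiff.contMDiffAt
    have hsnd : ContMDiffAt 𝓘(ℝ, E × EH) 𝓘(ℝ, EH) ∞ (Prod.snd : E × EH → EH) z :=
      contDiff_snd.contMDiff.contMDiffAt
    exact ContMDiffAt.comp (g := fun z : 𝒢 × H => act z.1 z.2) z hact.smooth.contMDiffAt
      (((contMDiffAt_extChartAt_symm h1).comp z hfst).prodMk
        ((contMDiffAt_extChartAt_symm h2).comp z hsnd))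
  have htφ : φ u ∈ φ.target := mem_extChartAt_target u
  have htψ : ψ 1 ∈ ψ.target := mem_extChartAt_target (1 : H)
  have hFsm : ContMDiffAt 𝓘(ℝ, E × EH) 𝓘(ℝ, E) 2 F p := (hsm p htφ htψ).of_le two_le
  have hact1 : ∀ h : H, ContMDiff 𝓘(ℝ, E) 𝓘(ℝ, E) ∞ fun x => act x h := fun h =>
    hact.smooth.comp (contMDiff_id.prodMk contMDiff_const)
  have hact2 : ∀ x : 𝒢, ContMDiff 𝓘(ℝ, EH) 𝓘(ℝ, E) ∞ fun h => act x h := fun x =>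
    hact.smooth.comp (contMDiff_const.prodMk contMDiff_id)
  have hne : (∞ : WithTop ℕ∞) ≠ 0 := by simp
  -- the partial derivatives of `F`
  have hD1 : ∀ y ∈ φ.target, ∀ s ∈ ψ.target,
      mfderiv 𝓘(ℝ, E × EH) 𝓘(ℝ, E) F (y, s) ((v, 0) : E × EH) =
        mfderiv 𝓘(ℝ, E) 𝓘(ℝ, E) (fun x => act x (ψ.symm s)) (φ.symm y)
          (mfderiv 𝓘(ℝ, E) 𝓘(ℝ, E) φ.symm y v) := by
    intro y hy s hs
    have d0 : HasFDerivAt (fun y : E => (y, s)) (ContinuousLinearMap.inl ℝ E EH) y :=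
      hasFDerivAt_prodMk_left y s
    have c1 := mfderiv_comp y ((hsm (y, s) hy hs).mdifferentiableAt hne)
      d0.differentiableAt.mdifferentiableAt
    have c2 := mfderiv_comp y ((hact1 (ψ.symm s)).contMDiffAt.mdifferentiableAt hne)
      ((contMDiffAt_extChartAt_symm hy).mdifferentiableAt hne)
    have c3 := congrArg (fun L => L v) (c1.symm.trans c2)
    rw [mfderiv_eq_fderiv, d0.fderiv] at c3
    exact c3
  have hD2 : ∀ y ∈ φ.target,
      mfderiv 𝓘(ℝ, E × EH) 𝓘(ℝ, E) F (y, ψ 1) ((0, ζ) : E × EH) =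
        mfderiv 𝓘(ℝ, EH) 𝓘(ℝ, E) (fun h => act (φ.symm y) h) (ψ.symm (ψ 1)) ζ := by
    intro y hy
    have d0 : HasFDerivAt (fun s : EH => (y, s)) (ContinuousLinearMap.inr ℝ E EH) (ψ 1) :=
      hasFDerivAt_prodMk_right y (ψ 1)
    have c1 := mfderiv_comp (ψ 1) ((hsm (y, ψ 1) hy htψ).mdifferentiableAt hne)
      d0.differentiableAt.mdifferentiableAt
    have c2 := mfderiv_comp (ψ 1) ((hact2 (φ.symm y)).contMDiffAt.mdifferentiableAt hne)
      ((contMDiffAt_extChartAt_symm htψ).mdifferentiableAt hne)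
    have c3 := congrArg (fun L => L ζ) (c1.symm.trans c2)
    rw [mfderiv_eq_fderiv, d0.fderiv] at c3
    refine Eq.trans c3 (congrArg
      (mfderiv 𝓘(ℝ, EH) 𝓘(ℝ, E) (fun h => act (φ.symm y) h) (ψ.symm (ψ 1))) ?_)
    -- the derivative of `ψ.symm` at `ψ 1` is the identity
    have i1 : IsManifold 𝓘(ℝ, EH) 1 H := .of_le (n := ∞) (by simp)
    have h1 := mfderivWithin_range_extChartAt_symm (I := 𝓘(ℝ, EH)) (x := (1 : H))
    rw [modelWithCornersSelf_coe, Set.range_id, mfderivWithin_univ] at h1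
    exact congrArg (fun L => L ζ) h1
  have hφ' : mfderiv 𝓘(ℝ, E) 𝓘(ℝ, E) φ.symm (φ u) v = v := by
    have i1 : IsManifold 𝓘(ℝ, E) 1 𝒢 := .of_le (n := ∞) (by simp)
    have h1 := mfderivWithin_range_extChartAt_symm (I := 𝓘(ℝ, E)) (x := u)
    rw [modelWithCornersSelf_coe, Set.range_id, mfderivWithin_univ] at h1
    exact congrArg (fun L => L v) h1
  -- the connection form along `F`
  set C : E × EH → E × EH → Matrix N N ℝ := fun z w =>
    conn.form (F z) (mfderiv 𝓘(ℝ, E × EH) 𝓘(ℝ, E) F z w) with hC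
  have hC1 : ∀ s ∈ ψ.target, ρ (ψ.symm s) * C (φ u, s) (v, 0) = X * ρ (ψ.symm s) := by
    intro s hs
    have h1 : C (φ u, s) (v, 0) = ρ (ψ.symm s)⁻¹ * X * ρ (ψ.symm s) := by
      simp only [hC]
      rw [hD1 _ htφ s hs]
      refine (conn.equivariant (φ.symm (φ u)) (ψ.symm s) _).trans ?_
      rw [conn.form_congr hφu hφ', hv]
      simp
    rw [h1, ← mul_assoc, ← mul_assoc, ← map_mul]
    simp
  have hC2 : ∀ y ∈ φ.target, C (y, ψ 1) (0, ζ) = Y := by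
    intro y hy
    simp only [hC]
    rw [hD2 y hy, hY]
    exact conn.form_fundamental hψ1 (φ.symm y) ζ
  have hdiff : ∀ w i j, DifferentiableAt ℝ (fun z => C z w i j) p := by
    intro w i j
    have h := (conn.isSmoothOneForm_entry i j).differentiableAt_chartForm_pullback hFsm w
    simp only [chartForm_vectorSpace] at h
    simpa using! h
  -- the derivative of `C · (0, ζ)` in the direction of `v`
  have hder2 : ∀ i j, fderiv ℝ (fun z => C z (0, ζ) i j) p (v, 0) = 0 := by
    intro i j
    have d0 : HasFDerivAt (fun y : E => (y, ψ 1)) (ContinuousLinearMap.inl ℝ E EH) (φ u) :=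
      hasFDerivAt_prodMk_left (φ u) (ψ 1)
    have h1 := (hdiff (0, ζ) i j).hasFDerivAt.comp (φ u) d0
    have h2 : ((fun z => C z (0, ζ) i j) ∘ fun y : E => (y, ψ 1)) =ᶠ[nhds (φ u)]
        fun _ => (Y : Matrix N N ℝ) i j := by
      filter_upwards [(isOpen_extChartAt_target u).mem_nhds htφ] with y hy
      exact congrFun (congrFun (hC2 y hy) i) j
    have h3 := (h1.congr_of_eventuallyEq h2.symm).unique
      (hasFDerivAt_const ((Y : Matrix N N ℝ) i j) (φ u))
    simpa using congrArg (fun L => L v) h3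
  -- the derivative of `C · (v, 0)` in the direction of `ζ`
  have hder1 : ∀ i j, fderiv ℝ (fun z => C z (v, 0) i j) p (0, ζ) =
      ⁅(X : Matrix N N ℝ), (Y : Matrix N N ℝ)⁆ i j := by
    intro i j
    have d0 : HasFDerivAt (fun s : EH => (φ u, s)) (ContinuousLinearMap.inr ℝ E EH) (ψ 1) :=
      hasFDerivAt_prodMk_right (φ u) (ψ 1)
    have hCd : ∀ k l, HasFDerivAt (fun s => C (φ u, s) (v, 0) k l)
        (fderiv ℝ (fun z => C z (v, 0) k l) p ∘L ContinuousLinearMap.inr ℝ E EH) (ψ 1) :=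
      fun k l => (hdiff (v, 0) k l).hasFDerivAt.comp (ψ 1) d0
    have hρd : ∀ k l, ∃ L : EH →L[ℝ] ℝ, HasFDerivAt (fun s => ρ (ψ.symm s) k l) L (ψ 1) ∧
        L ζ = (Y : Matrix N N ℝ) k l := by
      intro k l
      have h1 : MDifferentiableAt 𝓘(ℝ, EH) 𝓘(ℝ, ℝ) (fun h : H => ρ h k l) 1 :=
        (hρ k l).contMDiffAt.mdifferentiableAt hne
      have h2 : ContDiffAt ℝ ∞ (fun s => ρ (ψ.symm s) k l) (ψ 1) :=
        (ContMDiffAt.comp (g := fun h : H => ρ h k l) (ψ 1) (hρ k l).contMDiffAt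
          (contMDiffAt_extChartAt_symm htψ)).contDiffAt
      refine ⟨_, (h2.differentiableAt hne).hasFDerivAt, ?_⟩
      rw [hY]
      have h3 := h1.mfderiv
      rw [modelWithCornersSelf_coe, Set.range_id, fderivWithin_univ] at h3
      exact (congrArg (fun L => L ζ) h3).symm
    choose L hL hLζ using hρd
    have e1 : HasFDerivAt (fun s => (ρ (ψ.symm s) * C (φ u, s) (v, 0)) i j)
        (∑ k, (ρ (ψ.symm (ψ 1)) i k •
          (fderiv ℝ (fun z => C z (v, 0) k j) p ∘L ContinuousLinearMap.inr ℝ E EH) +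
            C (φ u, ψ 1) (v, 0) k j • L i k)) (ψ 1) := by
      simp only [Matrix.mul_apply]
      exact HasFDerivAt.fun_sum fun k _ => (hL i k).mul (hCd k j)
    have e2 : HasFDerivAt (fun s => ((X : Matrix N N ℝ) * ρ (ψ.symm s)) i j)
        (∑ k, (X : Matrix N N ℝ) i k • L k j) (ψ 1) := by
      simp only [Matrix.mul_apply]
      exact HasFDerivAt.fun_sum fun k _ => (hL k j).const_mul _
    have e3 : (fun s => (ρ (ψ.symm s) * C (φ u, s) (v, 0)) i j) =ᶠ[nhds (ψ 1)]
        fun s => ((X : Matrix N N ℝ) * ρ (ψ.symm s)) i j := by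
      filter_upwards [(isOpen_extChartAt_target (1 : H)).mem_nhds htψ] with s hs
      rw [hC1 s hs]
    have e4 := congrArg (fun L => L ζ) ((e1.congr_of_eventuallyEq e3.symm).unique e2)
    have e5 : C (φ u, ψ 1) (v, 0) = X := by
      have := hC1 (ψ 1) htψ
      rwa [hψ1, map_one, one_mul, mul_one] at this
    simp only [hψ1, map_one, e5, sum_apply, add_apply,
      smul_apply, smul_eq_mul, hLζ, ContinuousLinearMap.comp_apply,
      ContinuousLinearMap.inr_apply, Finset.sum_add_distrib, Matrix.one_apply, ite_mul, one_mul,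
      zero_mul, Finset.sum_ite_eq, Finset.mem_univ, if_true] at e4
    rw [Ring.lie_def, Matrix.sub_apply, Matrix.mul_apply, Matrix.mul_apply, ← e4]
    rw [Finset.sum_congr rfl fun k _ => mul_comm ((X : Matrix N N ℝ) k j) _]
    ring
  have hX' : conn.form (F p) (mfderiv 𝓘(ℝ, E × EH) 𝓘(ℝ, E) F p (v, 0)) = X := by
    ext1
    have := hC1 (ψ 1) htψ
    rwa [hψ1, map_one, one_mul, mul_one] at this
  have hY' : conn.form (F p) (mfderiv 𝓘(ℝ, E × EH) 𝓘(ℝ, E) F p (0, ζ)) = Y :=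
    Subtype.ext (hC2 _ htφ)
  have key : conn.curvFun (F p) X Y = 0 := by
    ext i j
    have h := (conn.isSmoothOneForm_entry i j).extDer_pullback hFsm ((v, 0) : E × EH)
      ((0, ζ) : E × EH)
    rw [extDer_eq_chartForm] at h
    simp only [chartForm_vectorSpace] at h
    have h1 := hder1 i j
    have h2 := hder2 i j
    rw [curvFun, ← hX', ← hY', LinearEquiv.symm_apply_apply, LinearEquiv.symm_apply_apply,
      curv_apply, ← h, hX', hY', ← h1]
    have h3 : ∀ a b : ℝ, a = 0 → a - b + b = 0 := fun a b ha => by rw [ha]; ring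
    exact h3 _ _ h2
  rwa [hFp] at key

end CartanConnection

end ProjConf

namespace ProjConf

namespace CartanConnection

variable {N : Type*} [Fintype N] [DecidableEq N]
  {EH : Type*} [NormedAddCommGroup EH] [NormedSpace ℝ EH]
  {H : Type*} [TopologicalSpace H] [ChartedSpace EH H] [Group H] [IsManifold 𝓘(ℝ, EH) ∞ H]
  {E : Type*} [NormedAddCommGroup E] [NormedSpace ℝ E]
  {𝒢 : Type*} [TopologicalSpace 𝒢] [ChartedSpace E 𝒢] [IsManifold 𝓘(ℝ, E) ∞ 𝒢]
  {𝔤 : LieSubalgebra ℝ (Matrix N N ℝ)} {ρ : H →* Matrix N N ℝ} {act : 𝒢 → H → 𝒢}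
  (conn : CartanConnection EH E 𝔤 ρ act)

theorem curvBilin_eq_zero_right (hact : IsSmoothRightAction EH E act) {𝔥 : Submodule ℝ 𝔤}
    (hρ : IsLieRep EH ρ 𝔥) (u : 𝒢) (X : 𝔤) {Y : 𝔤} (hY : Y ∈ 𝔥) : conn.curvBilin u X Y = 0 := by
  have h : (Y : Matrix N N ℝ) ∈ Set.range
      (dRep ρ : TangentSpace 𝓘(ℝ, EH) (1 : H) → Matrix N N ℝ) := by
    rw [hρ.range_eq]
    exact ⟨Y, hY, rfl⟩
  obtain ⟨ζ, hζ⟩ := h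
  exact conn.curvFun_eq_zero_of_eq_dRep hact hρ.smooth u ζ X Y hζ.symm

theorem curvBilin_eq_zero_left (hact : IsSmoothRightAction EH E act) {𝔥 : Submodule ℝ 𝔤}
    (hρ : IsLieRep EH ρ 𝔥) (u : 𝒢) {X : 𝔤} (hX : X ∈ 𝔥) (Y : 𝔤) : conn.curvBilin u X Y = 0 := by
  rw [curvBilin_apply, curvFun_swap, ← curvBilin_apply,
    conn.curvBilin_eq_zero_right hact hρ u Y hX, neg_zero]

end CartanConnection

section Induced

variable {n : ℕ}

theorem bigsl_mem_soAlg (A : Matrix (Fin (n + 1)) (Fin (n + 1)) ℝ) : bigsl n A ∈ soAlg n := by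
  rw [mem_soAlg]
  simp [bigsl, LieAlgebra.Orthogonal.JD, Matrix.fromBlocks_multiply, Matrix.fromBlocks_transpose,
    Matrix.fromBlocks_neg]

/-- The inclusion `𝔰𝔩(n+1) → 𝔰𝔬(n+1, n+1)` as a linear map. -/
noncomputable def slToSo (n : ℕ) : slAlg n →ₗ[ℝ] soAlg n where
  toFun A := ⟨bigsl n A, bigsl_mem_soAlg _⟩
  map_add' A B := by
    ext1
    simp [bigsl, Matrix.fromBlocks_add, add_comm]
  map_smul' c A := by
    ext1
    simp [bigsl, Matrix.fromBlocks_smul]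

theorem coe_slToSo (A : slAlg n) : (slToSo n A : Matrix (Idx n) (Idx n) ℝ) = bigsl n A := rfl

theorem lie_bigsl (A B : Matrix (Fin (n + 1)) (Fin (n + 1)) ℝ) :
    ⁅bigsl n A, bigsl n B⁆ = bigsl n ⁅A, B⁆ := by
  rw [Ring.lie_def, Ring.lie_def, sub_eq_iff_eq_add]
  simp [bigsl, Matrix.fromBlocks_multiply, Matrix.fromBlocks_add]

variable {EP : Type*} [NormedAddCommGroup EP] [NormedSpace ℝ EP] [ChartedSpace EP (PGrp n)]
  {ET : Type*} [NormedAddCommGroup ET] [NormedSpace ℝ ET]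
  [TopologicalSpace (PtGrp n)] [ChartedSpace ET (PtGrp n)]
  {E : Type*} [NormedAddCommGroup E] [NormedSpace ℝ E]
  {𝒢 : Type*} [TopologicalSpace 𝒢] [ChartedSpace E 𝒢] [IsManifold 𝓘(ℝ, E) ∞ 𝒢]
  {E' : Type*} [NormedAddCommGroup E'] [NormedSpace ℝ E']
  {𝒢' : Type*} [TopologicalSpace 𝒢'] [ChartedSpace E' 𝒢'] [IsManifold 𝓘(ℝ, E') ∞ 𝒢']

theorem extDer_neg {M : Type*} [TopologicalSpace M] [ChartedSpace E M]
    (α : ∀ x : M, TangentSpace 𝓘(ℝ, E) x → ℝ) (x : M) (ξ η : E) :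
    extDer (fun z v => -α z v) x ξ η = -extDer α x ξ η := by
  have h : ∀ w : E, fderiv ℝ (fun y => chartForm (fun z v => -α z v) x (y, w))
      (extChartAt 𝓘(ℝ, E) x x) =
        -fderiv ℝ (fun y => chartForm α x (y, w)) (extChartAt 𝓘(ℝ, E) x x) :=
    fun w => fderiv_fun_neg
  rw [extDer_eq_chartForm, extDer_eq_chartForm]
  rw [h, h]
  simp only [neg_apply]
  ring

theorem extDer_zero {M : Type*} [TopologicalSpace M] [ChartedSpace E M]
    (x : M) (ξ η : TangentSpace 𝓘(ℝ, E) x) :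
    extDer (fun _ _ => 0) x ξ η = 0 := by
  simp only [extDer, fderiv_fun_const]
  exact sub_self (0 : ℝ)

/-- The curvature of the induced connection restricts to that of the original connection. -/
theorem curvBilin_induced {act : 𝒢 → PGrp n → 𝒢} {act' : 𝒢' → PtGrp n → 𝒢'} {j : 𝒢 → 𝒢'}
    (hj : ContMDiff 𝓘(ℝ, E) 𝓘(ℝ, E') ∞ j)
    {conn : CartanConnection EP E (slAlg n) (PRep n) act}
    {conn' : CartanConnection ET E' (soAlg n) (PtRep n) act'}
    (h : IsInducedConnection j conn conn') (u : 𝒢) (A B : slAlg n) :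
    conn'.curvBilin (j u) (slToSo n A) (slToSo n B) = bigsl n (conn.curvBilin u A B) := by
  have hsymm : ∀ A : slAlg n, (conn'.form (j u)).symm (slToSo n A) =
      mfderiv 𝓘(ℝ, E) 𝓘(ℝ, E') j u ((conn.form u).symm A) := by
    intro A
    rw [LinearEquiv.symm_apply_eq]
    ext1
    rw [h, coe_slToSo, LinearEquiv.apply_symm_apply]
  have hj2 : ContMDiffAt 𝓘(ℝ, E) 𝓘(ℝ, E') 2 j u :=
    hj.contMDiffAt.of_le (WithTop.coe_le_coe.2 le_top)
  rw [CartanConnection.curvBilin_apply, CartanConnection.curvBilin_apply,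
    CartanConnection.curvFun, CartanConnection.curvFun, hsymm, hsymm]
  set ξ := (conn.form u).symm A
  set η := (conn.form u).symm B
  have hext : ∀ a b, extDer (conn'.entry a b) (j u) (mfderiv 𝓘(ℝ, E) 𝓘(ℝ, E') j u ξ)
      (mfderiv 𝓘(ℝ, E) 𝓘(ℝ, E') j u η) =
        extDer (fun z v => bigsl n (conn.form z v) a b) u ξ η := by
    intro a b
    rw [← (conn'.isSmoothOneForm_entry a b).extDer_pullback hj2]
    congr 1
    funext z v
    exact congrFun (congrFun (h z v) a) b
  ext a b
  rw [CartanConnection.curv_apply, hext, h, h, lie_bigsl]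
  rcases a with a | a <;> rcases b with b | b
  · rfl
  · show extDer (fun _ _ => 0) u ξ η + 0 = 0
    rw [extDer_zero, add_zero]
  · show extDer (fun _ _ => 0) u ξ η + 0 = 0
    rw [extDer_zero, add_zero]
  · show extDer (fun z v => -conn.entry b a z v) u ξ η +
      -⁅(conn.form u ξ).1, (conn.form u η).1⁆ b a = -conn.curv u ξ η b a
    rw [CartanConnection.curv_apply, neg_add]
    exact congrArg (· + _) (extDer_neg (conn.entry b a) u ξ η)

end Induced

/-! ### Dual pairs of bases and the codifferential -/

section DualPair

variable {N : Type*} [Fintype N] [DecidableEq N] {𝔤 : LieSubalgebra ℝ (Matrix N N ℝ)}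
  {𝔭 : Submodule ℝ 𝔤} {ι ι' : Type*} [DecidableEq ι] [DecidableEq ι']

theorem killingForm_eq_zero_of_mem_pPlus {Z A : 𝔤} (hZ : Z ∈ pPlus 𝔭) (hA : A ∈ 𝔭) :
    killingForm ℝ 𝔤 Z A = 0 := by
  rw [LieModule.traceForm_comm]
  exact hZ A hA

theorem mem_pPlus_of_killingForm {Z : 𝔤} (hZ : ∀ A ∈ 𝔭, killingForm ℝ 𝔤 Z A = 0) :
    Z ∈ pPlus 𝔭 := by
  intro A hA
  exact (LieModule.traceForm_comm ℝ 𝔤 𝔤 A Z).trans (hZ A hA)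

theorem IsDualPair.reindex {X Z : ι → 𝔤} (h : IsDualPair 𝔭 X Z) (e : ι' ≃ ι) :
    IsDualPair 𝔭 (X ∘ e) (Z ∘ e) where
  linearIndependent := h.linearIndependent.comp e e.injective
  span_eq_top := by
    rw [← h.span_eq_top]
    congr 1
    exact e.surjective.range_comp fun i => 𝔭.mkQ (X i)
  mem_pPlus i := h.mem_pPlus (e i)
  killing i j := by simp [h.killing]

variable [Fintype ι] [Fintype ι']

/-- A criterion for dual pairs: duality, together with the fact that the `Z i` cut out `𝔭`. -/
theorem isDualPair_of_forall_killingForm {X Z : ι → 𝔤}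
    (hZ : ∀ i, ∀ A ∈ 𝔭, killingForm ℝ 𝔤 (Z i) A = 0)
    (hXZ : ∀ i j, killingForm ℝ 𝔤 (Z i) (X j) = if i = j then 1 else 0)
    (hmem : ∀ A, (∀ i, killingForm ℝ 𝔤 (Z i) A = 0) → A ∈ 𝔭) : IsDualPair 𝔭 X Z where
  linearIndependent := by
    rw [Fintype.linearIndependent_iff]
    intro c hc i
    have h : ∑ j, c j • X j ∈ 𝔭 := by
      rw [← Submodule.Quotient.mk_eq_zero, ← Submodule.mkQ_apply, map_sum]
      simpa using hc
    have h2 := hZ i _ h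
    simpa [hXZ] using h2
  span_eq_top := by
    rw [eq_top_iff]
    rintro y -
    obtain ⟨Y, rfl⟩ := 𝔭.mkQ_surjective y
    have h : Y - ∑ j, killingForm ℝ 𝔤 (Z j) Y • X j ∈ 𝔭 := hmem _ fun i => by simp [hXZ]
    have h2 : 𝔭.mkQ Y = ∑ j, killingForm ℝ 𝔤 (Z j) Y • 𝔭.mkQ (X j) := by
      have h3 := (Submodule.Quotient.mk_eq_zero 𝔭).2 h
      rw [← Submodule.mkQ_apply, map_sub, sub_eq_zero] at h3
      rw [h3]
      simp
    rw [h2]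
    exact Submodule.sum_mem _ fun j _ => Submodule.smul_mem _ _ (Submodule.subset_span ⟨j, rfl⟩)
  mem_pPlus i := mem_pPlus_of_killingForm (hZ i)
  killing := hXZ

namespace IsDualPair

theorem sub_sum_mem {X Z : ι → 𝔤} (h : IsDualPair 𝔭 X Z) (Y : 𝔤) :
    Y - ∑ i, killingForm ℝ 𝔤 (Z i) Y • X i ∈ 𝔭 := by
  have hY : 𝔭.mkQ Y ∈ Submodule.span ℝ (Set.range fun i => 𝔭.mkQ (X i)) := by
    rw [h.span_eq_top]
    trivial
  obtain ⟨c, hc⟩ := (Submodule.mem_span_range_iff_exists_fun ℝ).1 hY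
  have h1 : Y - ∑ i, c i • X i ∈ 𝔭 := by
    rw [← Submodule.Quotient.mk_eq_zero, ← Submodule.mkQ_apply, map_sub, ← hc]
    simp
  have h2 : ∀ j, killingForm ℝ 𝔤 (Z j) Y = c j := by
    intro j
    have h3 := killingForm_eq_zero_of_mem_pPlus (h.mem_pPlus j) h1
    rw [map_sub, sub_eq_zero] at h3
    rw [h3]
    simp [h.killing]
  simpa only [h2] using h1

theorem eq_sum_of_mem_pPlus {X Z : ι → 𝔤} (h : IsDualPair 𝔭 X Z)
    (hnd : ∀ A : 𝔤, (∀ B, killingForm ℝ 𝔤 A B = 0) → A = 0) {W : 𝔤} (hW : W ∈ pPlus 𝔭) :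
    W = ∑ i, killingForm ℝ 𝔤 W (X i) • Z i := by
  rw [← sub_eq_zero]
  refine hnd _ fun B => ?_
  have hmem : W - ∑ i, killingForm ℝ 𝔤 W (X i) • Z i ∈ pPlus 𝔭 :=
    Submodule.sub_mem _ hW (Submodule.sum_mem _ fun i _ => Submodule.smul_mem _ _ (h.mem_pPlus i))
  have h1 := killingForm_eq_zero_of_mem_pPlus hmem (h.sub_sum_mem B)
  rw [map_sub, sub_eq_zero] at h1
  rw [h1, map_sum]
  refine Finset.sum_eq_zero fun j _ => ?_
  rw [map_smul, map_sub, LinearMap.sub_apply, map_sum, LinearMap.sum_apply]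
  simp [h.killing]

/-- The element `∑ X_i ⊗ Z_i` of `𝔤 / 𝔭 ⊗ 𝔭₊` does not depend on the dual pair. -/
theorem sum_bilin_eq {X Z : ι → 𝔤} {X' Z' : ι' → 𝔤} (h : IsDualPair 𝔭 X Z)
    (h' : IsDualPair 𝔭 X' Z') (hnd : ∀ A : 𝔤, (∀ B, killingForm ℝ 𝔤 A B = 0) → A = 0)
    {W : Type*} [AddCommGroup W] [Module ℝ W] (Φ : 𝔤 →ₗ[ℝ] 𝔤 →ₗ[ℝ] W)
    (hΦ : ∀ A ∈ 𝔭, Φ A = 0) : ∑ i, Φ (X i) (Z i) = ∑ j, Φ (X' j) (Z' j) := by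
  have h1 : ∀ j, Φ (X' j) = ∑ i, killingForm ℝ 𝔤 (Z i) (X' j) • Φ (X i) := by
    intro j
    have := hΦ _ (h.sub_sum_mem (X' j))
    rw [map_sub, sub_eq_zero] at this
    rw [this]
    simp
  calc ∑ i, Φ (X i) (Z i)
      = ∑ i, ∑ j, killingForm ℝ 𝔤 (Z i) (X' j) • Φ (X i) (Z' j) := by
        refine Finset.sum_congr rfl fun i _ => ?_
        conv_lhs => rw [h'.eq_sum_of_mem_pPlus hnd (h.mem_pPlus i)]
        simp
    _ = ∑ j, Φ (X' j) (Z' j) := by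
        rw [Finset.sum_comm]
        refine Finset.sum_congr rfl fun j _ => ?_
        rw [h1 j, LinearMap.sum_apply]
        rfl

/-- The codifferential does not depend on the choice of dual bases. -/
theorem codiff_eq {X Z : ι → 𝔤} {X' Z' : ι' → 𝔤} (h : IsDualPair 𝔭 X Z)
    (h' : IsDualPair 𝔭 X' Z') (hnd : ∀ A : 𝔤, (∀ B, killingForm ℝ 𝔤 A B = 0) → A = 0)
    (κ : 𝔤 →ₗ[ℝ] 𝔤 →ₗ[ℝ] Matrix N N ℝ) (hκ : ∀ A ∈ 𝔭, ∀ B, κ A B = 0) (Y : 𝔤) :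
    codiff X Z (fun A B => κ A B) Y = codiff X' Z' (fun A B => κ A B) Y := by
  let Φ : 𝔤 →ₗ[ℝ] 𝔤 →ₗ[ℝ] Matrix N N ℝ :=
    LinearMap.mk₂ ℝ (fun A B => (2 : ℝ) • ⁅κ A Y, (B : Matrix N N ℝ)⁆ + κ A ⁅B, Y⁆)
      (fun A A' B => by simp; abel) (fun c A B => by simp [smul_comm c (2 : ℝ)])
      (fun A B B' => by simp; abel) (fun c A B => by simp [smul_comm c (2 : ℝ)])
  have key := h.sum_bilin_eq h' hnd Φ fun A hA => by
    ext1 B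
    simp [Φ, hκ A hA]
  simpa [Φ, codiff, Finset.sum_add_distrib, Finset.smul_sum] using key

theorem finrank_eq {X Z : ι → 𝔤} (h : IsDualPair 𝔭 X Z) :
    Module.finrank ℝ (𝔤 ⧸ 𝔭) = Fintype.card ι := by
  rw [← finrank_top, ← h.span_eq_top, finrank_span_eq_card h.linearIndependent]

end IsDualPair

end DualPair

/-- The normalisation condition may be tested on dual pairs with any index set. -/
theorem CartanConnection.IsNormal.codiff_eq_zero {N : Type*} [Fintype N] [DecidableEq N]
    {EH : Type*} [NormedAddCommGroup EH] [NormedSpace ℝ EH]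
    {H : Type*} [TopologicalSpace H] [ChartedSpace EH H] [Group H]
    {E : Type*} [NormedAddCommGroup E] [NormedSpace ℝ E]
    {𝒢 : Type*} [TopologicalSpace 𝒢] [ChartedSpace E 𝒢] [IsManifold 𝓘(ℝ, E) ∞ 𝒢]
    {𝔤 : LieSubalgebra ℝ (Matrix N N ℝ)} {ρ : H →* Matrix N N ℝ} {act : 𝒢 → H → 𝒢}
    {conn : CartanConnection EH E 𝔤 ρ act} {𝔭 : Submodule ℝ 𝔤} (hconn : conn.IsNormal 𝔭)
    {ι : Type*} [DecidableEq ι] [Fintype ι] {X Z : ι → 𝔤} (h : IsDualPair 𝔭 X Z) (u : 𝒢) (Y : 𝔤) :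
    codiff X Z (conn.curvFun u) Y = 0 := by
  let e : Fin (Module.finrank ℝ (𝔤 ⧸ 𝔭)) ≃ ι := (Fintype.equivFinOfCardEq h.finrank_eq.symm).symm
  rw [← hconn _ _ (h.reindex e) u Y, codiff, codiff]
  congr 1
  · rw [← Equiv.sum_comp e]
    rfl
  · rw [← Equiv.sum_comp e]
    rfl

end ProjConf

/-! ### Dual bases and the normalisation condition for `𝔰𝔩(n+1)` -/

namespace ProjConf

variable {n : ℕ}

theorem mem_slP {A : slAlg n} : A ∈ slP n ↔
    ∀ i : Fin n, (A : Matrix (Fin (n + 1)) (Fin (n + 1)) ℝ) i.succ 0 = 0 := by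
  show (∃ c : ℝ, (A : Matrix (Fin (n + 1)) (Fin (n + 1)) ℝ) *ᵥ vPlus n = c • vPlus n) ↔ _
  simp only [vPlus, Matrix.mulVec_single_one]
  constructor
  · rintro ⟨c, hc⟩ i
    simpa using congrFun hc i.succ
  · intro h
    refine ⟨(A : Matrix (Fin (n + 1)) (Fin (n + 1)) ℝ) 0 0, funext fun a => ?_⟩
    refine Fin.cases ?_ (fun i => ?_) a
    · simp
    · simp [h i]

/-- The basis `E_{i0}` of `𝔤 / 𝔭 = 𝔰𝔩(n+1) / 𝔭`. -/
def slX (i : Fin n) : slAlg n := LieAlgebra.SpecialLinear.single i.succ 0 (Fin.succ_ne_zero i) 1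

/-- The basis of `𝔭₊ ⊆ 𝔰𝔩(n+1)` dual to `slX`. -/
noncomputable def slZ (i : Fin n) : slAlg n :=
  LieAlgebra.SpecialLinear.single 0 i.succ (Fin.succ_ne_zero i).symm (2 * (n + 1 : ℝ))⁻¹

theorem coe_slX (i : Fin n) :
    (slX i : Matrix (Fin (n + 1)) (Fin (n + 1)) ℝ) = Matrix.single i.succ 0 1 := rfl

theorem coe_slZ (i : Fin n) : (slZ i : Matrix (Fin (n + 1)) (Fin (n + 1)) ℝ) =
    Matrix.single 0 i.succ (2 * (n + 1 : ℝ))⁻¹ := rfl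

theorem killingForm_slZ (i : Fin n) (A : slAlg n) : killingForm ℝ (slAlg n) (slZ i) A =
    (A : Matrix (Fin (n + 1)) (Fin (n + 1)) ℝ) i.succ 0 := by
  have : (2 * (n + 1 : ℝ)) ≠ 0 := by positivity
  rw [killingForm_slAlg, coe_slZ, Matrix.trace_single_mul]
  simp only [smul_eq_mul]
  rw [mul_inv_cancel_left₀ this]

theorem isDualPair_sl : IsDualPair (slP n) (slX (n := n)) slZ :=
  isDualPair_of_forall_killingForm
    (fun i A hA => by rw [killingForm_slZ, mem_slP.1 hA])
    (fun i j => by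
      rw [killingForm_slZ, coe_slX, Matrix.single_apply]
      simp [eq_comm])
    (fun A hA => mem_slP.2 fun i => by rw [← killingForm_slZ, hA])

theorem lie_slZ_mem (i : Fin n) (Y : slAlg n) : ⁅slZ i, Y⁆ ∈ slP n := by
  rw [mem_slP]
  intro l
  rw [LieSubalgebra.coe_bracket, Ring.lie_def, coe_slZ]
  rw [Matrix.sub_apply, Matrix.single_mul_apply_of_ne _ _ _ _ _ (Fin.succ_ne_zero l),
    Matrix.mul_single_apply_of_ne _ _ _ _ _ (Fin.succ_ne_zero i).symm, sub_zero]

/-- The normalisation condition in terms of the entries of the matrices `κ(E_{i0}, Y)`: the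
terms `κ(X_i, [Z_i, Y])` of the codifferential vanish, as `[𝔭₊, 𝔤] ⊆ 𝔭`. -/
theorem sum_entries_eq_zero (κ : slAlg n →ₗ[ℝ] slAlg n →ₗ[ℝ] Matrix (Fin (n + 1)) (Fin (n + 1)) ℝ)
    (hκ : ∀ A, ∀ B ∈ slP n, κ A B = 0) (Y : slAlg n)
    (hnormal : codiff slX slZ (fun A B => κ A B) Y = 0) (a b : Fin (n + 1)) :
    ∑ i : Fin n, ((if i.succ = b then (κ (slX i) Y : Matrix _ _ ℝ) a 0 else 0) -
      if a = 0 then (κ (slX i) Y : Matrix _ _ ℝ) i.succ b else 0) = 0 := by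
  have h1 : ∑ i : Fin n, κ (slX i) ⁅slZ i, Y⁆ = 0 :=
    Finset.sum_eq_zero fun i _ => hκ _ _ (lie_slZ_mem i Y)
  rw [codiff, h1, add_zero, smul_eq_zero, or_iff_right (by norm_num)] at hnormal
  have h2 := congrFun (congrFun hnormal a) b
  have hc : (2 * (n + 1 : ℝ))⁻¹ ≠ 0 := by positivity
  have h3 : ∀ i : Fin n, ⁅κ (slX i) Y, (slZ i : Matrix (Fin (n + 1)) (Fin (n + 1)) ℝ)⁆ a b =
      (2 * (n + 1 : ℝ))⁻¹ * ((if i.succ = b then (κ (slX i) Y : Matrix _ _ ℝ) a 0 else 0) -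
        if a = 0 then (κ (slX i) Y : Matrix _ _ ℝ) i.succ b else 0) := by
    intro i
    generalize κ (slX i) Y = K
    rw [Ring.lie_def, coe_slZ, Matrix.sub_apply, mul_sub]
    congr 1
    · split_ifs with h
      · rw [← h, Matrix.mul_single_apply_same, mul_comm]
      · rw [Matrix.mul_single_apply_of_ne _ _ _ _ _ (Ne.symm h), mul_zero]
    · split_ifs with h
      · rw [h, Matrix.single_mul_apply_same]
      · rw [Matrix.single_mul_apply_of_ne _ _ _ _ _ h, mul_zero]
  rw [Matrix.sum_apply, Finset.sum_congr rfl fun i _ => h3 i, ← Finset.mul_sum] at h2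
  exact (mul_eq_zero.1 h2).resolve_left hc

/-- A normal projective Cartan geometry is torsion-free: its curvature has values in `𝔭`. -/
theorem torsion_eq_zero (κ : slAlg n →ₗ[ℝ] slAlg n →ₗ[ℝ] Matrix (Fin (n + 1)) (Fin (n + 1)) ℝ)
    (hκ : ∀ A, ∀ B ∈ slP n, κ A B = 0) (Y : slAlg n)
    (hnormal : codiff slX slZ (fun A B => κ A B) Y = 0) (i l : Fin n) :
    (κ (slX i) Y : Matrix _ _ ℝ) l.succ 0 = 0 := by
  simpa using sum_entries_eq_zero κ hκ Y hnormal l.succ i.succ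

/-- The Ricci-type trace condition on the curvature of a normal projective Cartan geometry. -/
theorem sum_curvature_eq (κ : slAlg n →ₗ[ℝ] slAlg n →ₗ[ℝ] Matrix (Fin (n + 1)) (Fin (n + 1)) ℝ)
    (hκ : ∀ A, ∀ B ∈ slP n, κ A B = 0) (Y : slAlg n)
    (hnormal : codiff slX slZ (fun A B => κ A B) Y = 0) (l : Fin n) :
    ∑ i : Fin n, (κ (slX i) Y : Matrix _ _ ℝ) i.succ l.succ =
      (κ (slX l) Y : Matrix _ _ ℝ) 0 0 := by
  have h := sum_entries_eq_zero κ hκ Y hnormal 0 l.succ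
  simp only [Finset.sum_sub_distrib, Fin.succ_inj, Finset.sum_ite_eq', Finset.mem_univ,
    if_true] at h
  linarith

/-! ### Dual bases for `𝔰𝔬(n+1, n+1)` -/

local notation "J" => LieAlgebra.Orthogonal.JD (Fin (n + 1)) ℝ

/-- The standard basis vectors of `E`. -/
def eVec (a : Fin (n + 1)) : Idx n → ℝ := Pi.single (Sum.inl a) 1

/-- The standard basis vectors of `F`. -/
def fVec (a : Fin (n + 1)) : Idx n → ℝ := Pi.single (Sum.inr a) 1

theorem vTilde_eq : vTilde n = eVec 0 + fVec (Fin.last n) := by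
  funext a
  rcases a with a | a <;> simp [vTilde, eVec, fVec, Pi.single_apply]

theorem hForm_eq (v w : Idx n → ℝ) :
    hForm n v w = ∑ a, (v (Sum.inl a) * w (Sum.inr a) + v (Sum.inr a) * w (Sum.inl a)) := by
  simp [hForm, LieAlgebra.Orthogonal.JD, dotProduct, Matrix.mulVec, Matrix.fromBlocks,
    Matrix.one_apply, Finset.sum_add_distrib]

theorem hForm_comm (v w : Idx n → ℝ) : hForm n v w = hForm n w v := by
  rw [hForm_eq, hForm_eq]
  exact Finset.sum_congr rfl fun a _ => by ring

theorem hForm_fVec (a : Fin (n + 1)) (w : Idx n → ℝ) : hForm n (fVec a) w = w (Sum.inl a) := by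
  simp [hForm_eq, fVec, Pi.single_apply]

theorem hForm_eVec (a : Fin (n + 1)) (w : Idx n → ℝ) : hForm n (eVec a) w = w (Sum.inr a) := by
  simp [hForm_eq, eVec, Pi.single_apply]

theorem hForm_add_left (v v' w : Idx n → ℝ) :
    hForm n (v + v') w = hForm n v w + hForm n v' w := by
  simp [hForm]

theorem hForm_smul_left (c : ℝ) (v w : Idx n → ℝ) : hForm n (c • v) w = c * hForm n v w := by
  simp [hForm]

theorem hForm_smul_right (c : ℝ) (v w : Idx n → ℝ) : hForm n v (c • w) = c * hForm n v w := by
  rw [hForm_comm, hForm_smul_left, hForm_comm]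

theorem hForm_sub_left (v v' w : Idx n → ℝ) :
    hForm n (v - v') w = hForm n v w - hForm n v' w := by
  simp [hForm, sub_dotProduct]

theorem hForm_vTilde_left (w : Idx n → ℝ) :
    hForm n (vTilde n) w = w (Sum.inr 0) + w (Sum.inl (Fin.last n)) := by
  rw [vTilde_eq, hForm_add_left, hForm_eVec, hForm_fVec]

theorem hForm_vTilde_self (hn : n ≠ 0) : hForm n (vTilde n) (vTilde n) = 0 := by
  have : (Fin.last n) ≠ 0 := by simpa [Fin.ext_iff] using hn
  rw [hForm_vTilde_left]
  simp [vTilde, this, this.symm]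

/-- Elements of `𝔰𝔬(n+1, n+1)` are skew-symmetric for `h`. -/
theorem hForm_mulVec_left {A : Matrix (Idx n) (Idx n) ℝ} (hA : A ∈ soAlg n) (v w : Idx n → ℝ) :
    hForm n (A *ᵥ v) w = -hForm n v (A *ᵥ w) := by
  rw [hForm, hForm, ← Matrix.vecMul_transpose, ← Matrix.dotProduct_mulVec, Matrix.mulVec_mulVec,
    mem_soAlg.1 hA, Matrix.neg_mulVec, dotProduct_neg, Matrix.mulVec_mulVec]

theorem hForm_mulVec_self {A : Matrix (Idx n) (Idx n) ℝ} (hA : A ∈ soAlg n) (v : Idx n → ℝ) :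
    hForm n v (A *ᵥ v) = 0 := by
  have h := hForm_mulVec_left hA v v
  rw [hForm_comm] at h
  linarith

theorem wedge_mulVec (v w x : Idx n → ℝ) :
    wedge n v w *ᵥ x = hForm n v x • w - hForm n w x • v := by
  have h : ∀ y : Idx n → ℝ, (J *ᵥ y) ⬝ᵥ x = hForm n y x := by
    intro y
    rw [hForm_comm, hForm, dotProduct_comm]
  rw [wedge, Matrix.sub_mulVec, Matrix.vecMulVec_mulVec, Matrix.vecMulVec_mulVec, h, h]
  simp

theorem wedge_mem_soAlg (v w : Idx n → ℝ) : wedge n v w ∈ soAlg n := by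
  have h : ∀ y : Idx n → ℝ, y ᵥ* J = J *ᵥ y := by
    intro y
    conv_lhs => rw [← JD_transpose]
    exact Matrix.vecMul_transpose _ _
  rw [mem_soAlg, wedge, Matrix.transpose_sub, Matrix.transpose_vecMulVec,
    Matrix.transpose_vecMulVec, sub_mul, mul_sub, Matrix.vecMulVec_mul, Matrix.vecMulVec_mul,
    Matrix.mul_vecMulVec, Matrix.mul_vecMulVec, h, h, neg_sub]

theorem lie_wedge {A : Matrix (Idx n) (Idx n) ℝ} (hA : A ∈ soAlg n) (v w : Idx n → ℝ) :
    ⁅A, wedge n v w⁆ = wedge n (A *ᵥ v) w + wedge n v (A *ᵥ w) := by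
  have h : ∀ y : Idx n → ℝ, (J *ᵥ y) ᵥ* A = -(J *ᵥ (A *ᵥ y)) := by
    intro y
    rw [← Matrix.mulVec_transpose, Matrix.mulVec_mulVec, mem_soAlg.1 hA, Matrix.neg_mulVec,
      Matrix.mulVec_mulVec]
  rw [Ring.lie_def, wedge, wedge, wedge, sub_mul, mul_sub, Matrix.mul_vecMulVec,
    Matrix.mul_vecMulVec, Matrix.vecMulVec_mul, Matrix.vecMulVec_mul, h, h, Matrix.vecMulVec_neg,
    Matrix.vecMulVec_neg]
  abel

/-- `(v, w) ↦ v ∧ w` as a bilinear map. -/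
noncomputable def wedgeBilin (n : ℕ) :
    (Idx n → ℝ) →ₗ[ℝ] (Idx n → ℝ) →ₗ[ℝ] Matrix (Idx n) (Idx n) ℝ :=
  LinearMap.mk₂ ℝ (wedge n)
    (fun v v' w => by
      simp only [wedge, Matrix.mulVec_add, Matrix.vecMulVec_add, Matrix.add_vecMulVec]
      abel)
    (fun c v w => by
      simp only [wedge, Matrix.mulVec_smul, Matrix.vecMulVec_smul, Matrix.smul_vecMulVec, smul_sub])
    (fun v w w' => by
      simp only [wedge, Matrix.mulVec_add, Matrix.vecMulVec_add, Matrix.add_vecMulVec]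
      abel)
    (fun c v w => by
      simp only [wedge, Matrix.mulVec_smul, Matrix.vecMulVec_smul, Matrix.smul_vecMulVec, smul_sub])

theorem wedgeBilin_apply (v w : Idx n → ℝ) : wedgeBilin n v w = wedge n v w := rfl

theorem mem_soP {A : soAlg n} :
    A ∈ soP n ↔ ∃ c : ℝ, (A : Matrix (Idx n) (Idx n) ℝ) *ᵥ vTilde n = c • vTilde n := Iff.rfl

/-- The element of `𝔭̃₊ = L ∧ L^⊥` that corresponds to `z ∈ L^⊥` under the Killing form. -/
noncomputable def soZ (z : Idx n → ℝ) : soAlg n :=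
  ⟨(-(4 * n : ℝ)⁻¹) • wedge n (vTilde n) z, (soAlg n).smul_mem _ (wedge_mem_soAlg _ _)⟩

theorem coe_soZ (z : Idx n → ℝ) : (soZ z : Matrix (Idx n) (Idx n) ℝ) =
    (-(4 * n : ℝ)⁻¹) • wedge n (vTilde n) z := rfl

theorem killingForm_soZ (hn : n ≠ 0) (z : Idx n → ℝ) (A : soAlg n) :
    killingForm ℝ (soAlg n) (soZ z) A =
      hForm n z ((A : Matrix (Idx n) (Idx n) ℝ) *ᵥ vTilde n) := by
  have htr : ∀ v w : Idx n → ℝ,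
      ((A : Matrix (Idx n) (Idx n) ℝ) * Matrix.vecMulVec w (J *ᵥ v)).trace =
        hForm n v ((A : Matrix (Idx n) (Idx n) ℝ) *ᵥ w) := by
    intro v w
    rw [Matrix.mul_vecMulVec, Matrix.trace_vecMulVec, hForm_comm, hForm]
  have hn' : (n : ℝ) ≠ 0 := by exact_mod_cast hn
  rw [killingForm_soAlg, Matrix.trace_mul_comm, coe_soZ, mul_smul_comm, Matrix.trace_smul, wedge,
    mul_sub, Matrix.trace_sub, htr, htr, hForm_comm (vTilde n),
    hForm_mulVec_left A.2]
  simp only [smul_eq_mul]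
  field_simp
  ring

theorem lie_soZ_mem (hn : n ≠ 0) {z : Idx n → ℝ} (hz : hForm n (vTilde n) z = 0) (Y : soAlg n) :
    ⁅soZ z, Y⁆ ∈ soP n := by
  rw [mem_soP, LieSubalgebra.coe_bracket, coe_soZ, smul_lie, ← lie_skew, lie_wedge Y.2]
  simp only [smul_neg, Matrix.neg_mulVec, Matrix.smul_mulVec, Matrix.add_mulVec, wedge_mulVec,
    hForm_vTilde_self hn, hForm_comm z, hz, hForm_comm (_ *ᵥ vTilde n),
    hForm_mulVec_self Y.2, zero_smul, sub_zero, zero_sub, zero_add]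
  exact ⟨_, by rw [← neg_smul, ← neg_smul, smul_smul]⟩

theorem bigsl_mulVec_eVec (A : Matrix (Fin (n + 1)) (Fin (n + 1)) ℝ) (a : Fin (n + 1)) :
    bigsl n A *ᵥ eVec a = ∑ b, A b a • eVec b := by
  rw [eVec, Matrix.mulVec_single_one]
  funext c
  rcases c with c | c <;> simp [bigsl, eVec, Finset.sum_apply, Pi.single_apply]

theorem bigsl_mulVec_fVec (A : Matrix (Fin (n + 1)) (Fin (n + 1)) ℝ) (a : Fin (n + 1)) :
    bigsl n A *ᵥ fVec a = -∑ b, A a b • fVec b := by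
  rw [fVec, Matrix.mulVec_single_one]
  funext c
  rcases c with c | c <;> simp [bigsl, fVec, Finset.sum_apply, Pi.single_apply]

/-- The vector `E_{i0} ṽ₊ ∈ L^⊥`. The correction by `f^0` comes from `-E_{i0}ᵗ f^n`. -/
def gVec (i : Fin n) : Idx n → ℝ := eVec i.succ - if i.succ = Fin.last n then fVec 0 else 0

theorem bigsl_slX_mulVec (hn : n ≠ 0) (i : Fin n) :
    bigsl n (slX i) *ᵥ vTilde n = gVec i := by
  have hlast : Fin.last n ≠ 0 := by simpa [Fin.ext_iff] using hn
  rw [vTilde_eq, Matrix.mulVec_add, bigsl_mulVec_eVec, bigsl_mulVec_fVec, coe_slX, gVec]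
  simp only [Matrix.single_apply, sub_eq_add_neg]
  congr 1
  · simp [ite_smul]
  · congr 1
    split_ifs with h <;> simp [h, ite_smul]

theorem hForm_gVec (i : Fin n) (w : Idx n → ℝ) : hForm n (gVec i) w =
    w (Sum.inr i.succ) - if i.succ = Fin.last n then w (Sum.inl 0) else 0 := by
  rw [gVec, hForm_sub_left, hForm_eVec]
  split_ifs
  · rw [hForm_fVec]
  · simp [hForm]

/-- Every `f^b` with `b ≠ 0` is of the form `B ṽ₊` with a vertical `B ∈ 𝔭`. The diagonal
correction that makes `B` traceless for `b = n` needs a third index, hence `n ≥ 2`. -/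
theorem exists_mem_slP_mulVec_eq_fVec (hn : 2 ≤ n) {b : Fin (n + 1)} (hb : b ≠ 0) :
    ∃ B ∈ slP n, bigsl n B *ᵥ vTilde n = fVec b := by
  obtain ⟨o, ho0, hol⟩ : ∃ o : Fin (n + 1), o ≠ 0 ∧ o ≠ Fin.last n :=
    ⟨⟨1, by omega⟩, by simp [Fin.ext_iff], by simp [Fin.ext_iff]; omega⟩
  set B : Matrix (Fin (n + 1)) (Fin (n + 1)) ℝ := -Matrix.single (Fin.last n) b 1 +
    (if b = Fin.last n then Matrix.single o o 1 else 0) with hB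
  have htr : B ∈ slAlg n := by
    rw [mem_slAlg, hB]
    by_cases h : b = Fin.last n
    · subst h
      simp
    · simp [h, Matrix.trace_single_eq_of_ne _ _ _ (Ne.symm h)]
  have hcol : ∀ a, B a 0 = 0 := by
    intro a
    rw [hB, Matrix.add_apply, Matrix.neg_apply, Matrix.single_apply_of_col_ne _ _ hb, neg_zero,
      zero_add]
    split_ifs
    · rw [Matrix.single_apply_of_col_ne _ _ ho0]
    · rfl
  have hrow : ∀ a, B (Fin.last n) a = if a = b then -1 else 0 := by
    intro a
    have h : (if b = Fin.last n then Matrix.single o o (1 : ℝ) else 0) (Fin.last n) a = 0 := by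
      split_ifs
      · exact Matrix.single_apply_of_row_ne hol _ _ _
      · rfl
    rw [hB, Matrix.add_apply, h, Matrix.neg_apply, Matrix.single_apply]
    by_cases hab : a = b
    · simp [hab]
    · simp [hab, Ne.symm hab]
  refine ⟨⟨B, htr⟩, mem_slP.2 fun i => hcol _, ?_⟩
  rw [vTilde_eq, Matrix.mulVec_add, bigsl_mulVec_eVec, bigsl_mulVec_fVec]
  simp [hcol, hrow, ite_smul]

end ProjConf

namespace ProjConf

variable {n : ℕ}

theorem last_ne_zero_of_ne (hn : n ≠ 0) : Fin.last n ≠ 0 := by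
  simpa [Fin.ext_iff] using hn

theorem gVec_inl (i : Fin n) (a : Fin (n + 1)) :
    gVec i (Sum.inl a) = if a = i.succ then 1 else 0 := by
  rw [gVec]
  split_ifs <;> simp_all [eVec, fVec]

theorem hForm_fVec_vTilde (i : Fin n) : hForm n (fVec i.succ) (vTilde n) = 0 := by
  simp [hForm_fVec, vTilde]

theorem hForm_gVec_vTilde (i : Fin n) : hForm n (gVec i) (vTilde n) = 0 := by
  simp [hForm_gVec, vTilde, Pi.single_apply]

/-- The elements `E_{i0}` of `𝔰𝔩(n+1)`, together with vertical elements `B i` that correspond to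
`f^{i+1}`, form a basis of `𝔤̃ / 𝔭̃`; the two halves are isotropic and in duality for `h`, so the
dual basis is obtained by exchanging them. -/
theorem isDualPair_so (hn : n ≠ 0) {B : Fin n → slAlg n}
    (hB : ∀ i, bigsl n (B i) *ᵥ vTilde n = fVec i.succ) :
    IsDualPair (soP n)
      (Sum.elim (fun i => slToSo n (slX i)) (fun i => slToSo n (B i)))
      (Sum.elim (fun i => soZ (fVec i.succ)) (fun i => soZ (gVec i))) := by
  refine isDualPair_of_forall_killingForm ?_ ?_ ?_
  · rintro i A ⟨c, hc⟩
    rcases i with i | i <;>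
      simp only [Sum.elim_inl, Sum.elim_inr, killingForm_soZ hn, hc, hForm_smul_right,
        hForm_fVec_vTilde, hForm_gVec_vTilde, mul_zero]
  · rintro (i | i) (l | l) <;>
      simp only [Sum.elim_inl, Sum.elim_inr, killingForm_soZ hn, coe_slToSo, hB,
        bigsl_slX_mulVec hn, hForm_fVec, hForm_gVec, Sum.inl.injEq, Sum.inr.injEq, reduceCtorEq,
        if_false]
    · rw [gVec_inl]
      simp only [Fin.succ_inj]
    · simp [fVec]
    · by_cases h : l.succ = Fin.last n <;> by_cases h' : i.succ = Fin.last n <;>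
        simp [gVec, eVec, fVec, h, h', hn, (Fin.succ_ne_zero _).symm]
    · simp [fVec, Pi.single_apply]
  · intro A hA
    set w := (A : Matrix (Idx n) (Idx n) ℝ) *ᵥ vTilde n with hw
    have h1 : ∀ i : Fin n, w (Sum.inl i.succ) = 0 := fun i => by
      simpa [killingForm_soZ hn, hForm_fVec] using hA (Sum.inl i)
    have h2 : ∀ i : Fin n, w (Sum.inr i.succ) =
        if i.succ = Fin.last n then w (Sum.inl 0) else 0 := fun i => by
      have := hA (Sum.inr i)
      simp only [Sum.elim_inr, killingForm_soZ hn, hForm_gVec] at this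
      exact sub_eq_zero.1 this
    have h3 : w (Sum.inr 0) = 0 := by
      obtain ⟨k, hk⟩ := Fin.exists_succ_eq.2 (last_ne_zero_of_ne hn)
      have h4 := hForm_mulVec_self A.2 (vTilde n)
      rwa [hForm_vTilde_left, ← hk, ← hw, h1, add_zero] at h4
    refine ⟨w (Sum.inl 0), ?_⟩
    rw [← hw]
    funext a
    rcases a with a | a <;> refine Fin.cases ?_ (fun i => ?_) a
    · simp [vTilde]
    · simp [vTilde, h1]
    · simp [vTilde, h3, (last_ne_zero_of_ne hn).symm]
    · simp [vTilde, h2, Pi.single_apply]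

/-! ### The codifferential of the conformal curvature -/

/-- The value of `∑ [K_i, ṽ₊ ∧ f^i]` for matrices `K_i` in `𝔭` that satisfy the trace condition of a
normal projective geometry. The terms with `e_0` add up to a multiple of `e_0 - ṽ₊ = -f^n`, by the
trace condition. -/
theorem sum_lie_wedge (hn : n ≠ 0) (K : Fin n → Matrix (Fin (n + 1)) (Fin (n + 1)) ℝ)
    (h1 : ∀ i l : Fin n, K i l.succ 0 = 0)
    (h2 : ∀ l : Fin n, ∑ i : Fin n, K i i.succ l.succ = K l 0 0) :
    ∑ i : Fin n, ⁅bigsl n (K i), wedge n (vTilde n) (fVec i.succ)⁆ =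
      -∑ i : Fin n, (K i 0 0 • wedge n (fVec (Fin.last n)) (fVec i.succ) +
        ∑ l : Fin n, K i (Fin.last n) l.succ • wedge n (fVec l.succ) (fVec i.succ)) := by
  obtain ⟨k, hk⟩ := Fin.exists_succ_eq.2 (last_ne_zero_of_ne hn)
  have e1 : ∀ i, bigsl n (K i) *ᵥ vTilde n =
      K i 0 0 • eVec 0 - ∑ l : Fin n, K i (Fin.last n) l.succ • fVec l.succ := by
    intro i
    rw [vTilde_eq, Matrix.mulVec_add, bigsl_mulVec_eVec, bigsl_mulVec_fVec, Fin.sum_univ_succ,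
      Fin.sum_univ_succ]
    simp [h1, ← hk, sub_eq_add_neg]
  have e2 : ∀ i : Fin n, bigsl n (K i) *ᵥ fVec i.succ =
      -∑ l : Fin n, K i i.succ l.succ • fVec l.succ := by
    intro i
    rw [bigsl_mulVec_fVec, Fin.sum_univ_succ]
    simp [h1]
  have e3 : ∑ i : Fin n, ∑ l : Fin n, K i i.succ l.succ • wedge n (vTilde n) (fVec l.succ) =
      ∑ l : Fin n, K l 0 0 • wedge n (vTilde n) (fVec l.succ) := by
    rw [Finset.sum_comm]
    exact Finset.sum_congr rfl fun l _ => by rw [← Finset.sum_smul, h2]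
  have e4 : ∀ w, wedge n (vTilde n) w = wedge n (eVec 0) w + wedge n (fVec (Fin.last n)) w := by
    intro w
    rw [vTilde_eq, ← wedgeBilin_apply, map_add]
    rfl
  have e5 : ∀ i : Fin n, ⁅bigsl n (K i), wedge n (vTilde n) (fVec i.succ)⁆ =
      K i 0 0 • wedge n (eVec 0) (fVec i.succ) -
        ∑ l : Fin n, K i (Fin.last n) l.succ • wedge n (fVec l.succ) (fVec i.succ) -
          ∑ l : Fin n, K i i.succ l.succ • wedge n (vTilde n) (fVec l.succ) := by
    intro i
    rw [lie_wedge (bigsl_mem_soAlg _), e1, e2]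
    simp only [← wedgeBilin_apply, map_sub, map_sum, map_smul, map_neg, LinearMap.sub_apply,
      LinearMap.sum_apply, LinearMap.smul_apply]
    rw [← sub_eq_add_neg]
  simp only [e5, Finset.sum_sub_distrib, e3, Finset.sum_add_distrib, neg_add]
  simp only [e4, smul_add, Finset.sum_add_distrib]
  abel

variable {κ : slAlg n →ₗ[ℝ] slAlg n →ₗ[ℝ] Matrix (Fin (n + 1)) (Fin (n + 1)) ℝ}
  {κ' : soAlg n →ₗ[ℝ] soAlg n →ₗ[ℝ] Matrix (Idx n) (Idx n) ℝ}

/-- The codifferential of the conformal curvature, in terms of the projective curvature. -/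
theorem codiff_conformal (hn : 2 ≤ n) (hκl : ∀ A ∈ slP n, ∀ B, κ A B = 0)
    (hκr : ∀ A, ∀ B ∈ slP n, κ A B = 0) (hκl' : ∀ A ∈ soP n, ∀ B, κ' A B = 0)
    (hκr' : ∀ A, ∀ B ∈ soP n, κ' A B = 0)
    (hind : ∀ A B, κ' (slToSo n A) (slToSo n B) = bigsl n (κ A B))
    (hnormal : ∀ Y, codiff slX slZ (fun A B => κ A B) Y = 0)
    {ι : Type*} [Fintype ι] [DecidableEq ι] {X Z : ι → soAlg n} (hXZ : IsDualPair (soP n) X Z)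
    (Y : soAlg n) :
    codiff X Z (fun A B => κ' A B) Y = (2 * n : ℝ)⁻¹ • ∑ i : Fin n, ∑ m : Fin n,
      (((Y : Matrix (Idx n) (Idx n) ℝ) *ᵥ vTilde n) (Sum.inl m.succ)) •
        ((κ (slX i) (slX m) : Matrix _ _ ℝ) 0 0 • wedge n (fVec (Fin.last n)) (fVec i.succ) +
          ∑ l : Fin n, (κ (slX i) (slX m) : Matrix _ _ ℝ) (Fin.last n) l.succ •
            wedge n (fVec l.succ) (fVec i.succ)) := by
  have hn0 : n ≠ 0 := by omega
  choose B hBmem hB using fun i : Fin n =>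
    exists_mem_slP_mulVec_eq_fVec hn (Fin.succ_ne_zero i)
  have hdual := isDualPair_so hn0 hB
  set y : Fin n → ℝ := fun m => ((Y : Matrix (Idx n) (Idx n) ℝ) *ᵥ vTilde n) (Sum.inl m.succ)
    with hy
  -- `Y` agrees modulo `𝔭̃` with an element of `𝔰𝔩(n+1)`
  have hY : ∀ A, κ' (slToSo n A) Y = bigsl n (∑ m, y m • κ A (slX m)) := by
    intro A
    have h := hκr' (slToSo n A) _ (hdual.sub_sum_mem Y)
    rw [map_sub, sub_eq_zero] at h
    rw [h, Fintype.sum_sum_type]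
    simp only [Sum.elim_inl, Sum.elim_inr, ← map_smul, ← map_sum, ← map_add]
    rw [hind]
    congr 1
    simp only [map_add, map_sum, map_smul, hκr A _ (hBmem _), smul_zero, Finset.sum_const_zero,
      add_zero, killingForm_soZ hn0, hForm_fVec, hy]
  set K : Fin n → Matrix (Fin (n + 1)) (Fin (n + 1)) ℝ := fun i => κ (slX i) (∑ m, y m • slX m)
    with hK
  have hK' : ∀ i, K i = ∑ m, y m • κ (slX i) (slX m) := fun i => by
    simp only [hK, map_sum, map_smul]
  have hZ2 : ∀ z, hForm n (vTilde n) z = 0 → ∀ A, κ' A ⁅soZ z, Y⁆ = 0 := fun z hz A =>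
    hκr' _ _ (lie_soZ_mem hn0 hz Y)
  rw [hXZ.codiff_eq hdual (eq_zero_of_killingForm_soAlg hn0) κ' hκl' Y, codiff,
    Fintype.sum_sum_type, Fintype.sum_sum_type]
  simp only [Sum.elim_inl, Sum.elim_inr]
  rw [Finset.sum_eq_zero (f := fun i => κ' (slToSo n (slX i)) ⁅soZ (fVec i.succ), Y⁆)
      fun i _ => hZ2 _ (by rw [hForm_comm, hForm_fVec_vTilde]) _,
    Finset.sum_eq_zero (f := fun i => κ' (slToSo n (B i)) ⁅soZ (gVec i), Y⁆)
      fun i _ => hZ2 _ (by rw [hForm_comm, hForm_gVec_vTilde]) _,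
    Finset.sum_eq_zero (f := fun i => ⁅κ' (slToSo n (B i)) Y,
      (soZ (gVec i) : Matrix (Idx n) (Idx n) ℝ)⁆)]
  swap
  · intro i _
    have h0 : bigsl n (0 : Matrix (Fin (n + 1)) (Fin (n + 1)) ℝ) = 0 := by simp [bigsl]
    rw [hY]
    simp [hκl _ (hBmem i), h0]
  simp only [hY, ← hK', coe_soZ, lie_smul, ← Finset.smul_sum]
  rw [sum_lie_wedge hn0 K (fun i l => torsion_eq_zero κ hκr _ (hnormal _) i l)
    (fun l => sum_curvature_eq κ hκr _ (hnormal _) l)]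
  simp only [add_zero, smul_neg, neg_smul, neg_neg, smul_smul]
  congr 1
  · field_simp
    norm_num
  · refine Finset.sum_congr rfl fun i _ => ?_
    rw [hK']
    simp only [Matrix.sum_apply, Matrix.smul_apply, smul_eq_mul, Finset.sum_smul, smul_add,
      Finset.sum_add_distrib, Finset.smul_sum, mul_smul]
    congr 1
    exact Finset.sum_comm

/-- A subspace that contains the forms `Y ↦ (Y ṽ₊)_a f^b ∧ f^c` with `a, b, c ≠ 0`, possibly after
application of a linear map `φ` to the values, contains the codifferential of the curvature. With
`φ` the identity and the projection modulo `𝔭̃₊`, this covers `∂̃^* κ̃` and its `𝔤̃₀`-part. -/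
theorem codiff_conformal_mem (hn : 2 ≤ n) (hκl : ∀ A ∈ slP n, ∀ B, κ A B = 0)
    (hκr : ∀ A, ∀ B ∈ slP n, κ A B = 0) (hκl' : ∀ A ∈ soP n, ∀ B, κ' A B = 0)
    (hκr' : ∀ A, ∀ B ∈ soP n, κ' A B = 0)
    (hind : ∀ A B, κ' (slToSo n A) (slToSo n B) = bigsl n (κ A B))
    (hnormal : ∀ Y, codiff slX slZ (fun A B => κ A B) Y = 0)
    {ι : Type*} [Fintype ι] [DecidableEq ι] {X Z : ι → soAlg n} (hXZ : IsDualPair (soP n) X Z)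
    {W : Type*} [AddCommGroup W] [Module ℝ W] (φ : Matrix (Idx n) (Idx n) ℝ →ₗ[ℝ] W)
    (S : Submodule ℝ (soAlg n → W))
    (hS : ∀ a b c : Fin (n + 1), a ≠ 0 → b ≠ 0 → c ≠ 0 →
      (fun Y : soAlg n => (((Y : Matrix (Idx n) (Idx n) ℝ) *ᵥ vTilde n) (Sum.inl a)) •
        φ (wedge n (fVec b) (fVec c))) ∈ S) :
    (fun Y => φ (codiff X Z (fun A B => κ' A B) Y)) ∈ S := by
  have hn0 : n ≠ 0 := by omega
  have h : (fun Y => φ (codiff X Z (fun A B => κ' A B) Y)) =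
      (2 * n : ℝ)⁻¹ • ∑ i : Fin n, ∑ m : Fin n,
        ((κ (slX i) (slX m) : Matrix _ _ ℝ) 0 0 •
            (fun Y : soAlg n => (((Y : Matrix (Idx n) (Idx n) ℝ) *ᵥ vTilde n) (Sum.inl m.succ)) •
              φ (wedge n (fVec (Fin.last n)) (fVec i.succ))) +
          ∑ l : Fin n, (κ (slX i) (slX m) : Matrix _ _ ℝ) (Fin.last n) l.succ •
            (fun Y : soAlg n => (((Y : Matrix (Idx n) (Idx n) ℝ) *ᵥ vTilde n) (Sum.inl m.succ)) •
              φ (wedge n (fVec l.succ) (fVec i.succ)))) := by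
    funext Y
    rw [codiff_conformal hn hκl hκr hκl' hκr' hind hnormal hXZ]
    simp only [map_smul, map_sum, map_add, Pi.smul_apply, Finset.sum_apply, Pi.add_apply, smul_add,
      Finset.smul_sum]
    simp only [smul_comm (((Y : Matrix (Idx n) (Idx n) ℝ) *ᵥ vTilde n) (Sum.inl _))]
  rw [h]
  refine S.smul_mem _ (S.sum_mem fun i _ => S.sum_mem fun m _ => S.add_mem (S.smul_mem _ ?_)
    (S.sum_mem fun l _ => S.smul_mem _ ?_))
  · exact hS _ _ _ (Fin.succ_ne_zero _) (last_ne_zero_of_ne hn0) (Fin.succ_ne_zero _)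
  · exact hS _ _ _ (Fin.succ_ne_zero _) (Fin.succ_ne_zero _) (Fin.succ_ne_zero _)

theorem fVec_mem_FBar {b : Fin (n + 1)} (hb : b ≠ 0) : fVec b ∈ FBar n := by
  refine ⟨fun a => by simp [fVec], ?_⟩
  rw [hForm_vTilde_left]
  simp [fVec, hb.symm]

theorem confForm_bigsl {A : Matrix (Fin (n + 1)) (Fin (n + 1)) ℝ} {a : Fin (n + 1)}
    (hA : bigsl n A *ᵥ vTilde n = fVec a) (Y : Matrix (Idx n) (Idx n) ℝ) :
    confForm n (bigsl n A) Y = (Y *ᵥ vTilde n) (Sum.inl a) := by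
  rw [confForm, hA, hForm_fVec]

end ProjConf

theorem mainTheorem4 (n : ℕ) (hn : 2 ≤ n)
    -- the Lie group structures of `P` and `P̃`
    {EP : Type*} [NormedAddCommGroup EP] [NormedSpace ℝ EP]
    [ChartedSpace EP (ProjConf.PGrp n)] [LieGroup 𝓘(ℝ, EP) ∞ (ProjConf.PGrp n)]
    (hP : ProjConf.IsLieRep EP (ProjConf.PRep n) (ProjConf.slP n))
    {ET : Type*} [NormedAddCommGroup ET] [NormedSpace ℝ ET]
    [TopologicalSpace (ProjConf.PtGrp n)]
    [ChartedSpace ET (ProjConf.PtGrp n)] [LieGroup 𝓘(ℝ, ET) ∞ (ProjConf.PtGrp n)]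
    (hPt : ProjConf.IsLieRep ET (ProjConf.PtRep n) (ProjConf.soP n))
    -- the inclusion `i : Q → P̃`, the lift of `A ↦ diag(A, (A⁻¹)ᵗ)` to the spin group
    (i : ProjConf.QGrp n →* ProjConf.PtGrp n) (hi : Continuous i)
    (hi_rep : ∀ q, ProjConf.PtRep n (i q) = ProjConf.bigSL n q.1.1)
    -- a normal projective Cartan geometry `(𝒢 → M, conn)` of type `(SL(n+1), P)`
    {M : Type*} [TopologicalSpace M] [ChartedSpace (EuclideanSpace ℝ (Fin n)) M]
    [IsManifold 𝓘(ℝ, EuclideanSpace ℝ (Fin n)) ∞ M]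
    {E : Type*} [NormedAddCommGroup E] [NormedSpace ℝ E]
    {𝒢 : Type*} [TopologicalSpace 𝒢] [ChartedSpace E 𝒢] [IsManifold 𝓘(ℝ, E) ∞ 𝒢]
    (π : 𝒢 → M) (act : 𝒢 → ProjConf.PGrp n → 𝒢)
    (h𝒢 : ProjConf.IsPrincipalBundle (EM := EuclideanSpace ℝ (Fin n)) EP E π act)
    (conn : ProjConf.CartanConnection EP E (ProjConf.slAlg n) (ProjConf.PRep n) act)
    (hconn : conn.IsNormal (ProjConf.slP n))
    -- the induced conformal Cartan geometry `(𝒢 ×_Q P̃, conn')` of type `(Spin(n+1,n+1), P̃)`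
    {E' : Type*} [NormedAddCommGroup E'] [NormedSpace ℝ E']
    {𝒢' : Type*} [TopologicalSpace 𝒢'] [ChartedSpace E' 𝒢'] [IsManifold 𝓘(ℝ, E') ∞ 𝒢']
    (act' : 𝒢' → ProjConf.PtGrp n → 𝒢') (j : 𝒢 → 𝒢')
    (h𝒢' : ProjConf.IsExtendedBundle ET E E' i act act' j)
    (conn' : ProjConf.CartanConnection ET E' (ProjConf.soAlg n) (ProjConf.PtRep n) act')
    (hconn' : ProjConf.IsInducedConnection j conn conn')
    -- dual bases of `𝔤̃ / 𝔭̃` and `𝔭̃₊`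
    (X Z : Fin (Module.finrank ℝ (ProjConf.soAlg n ⧸ ProjConf.soP n)) → ProjConf.soAlg n)
    (hXZ : ProjConf.IsDualPair (ProjConf.soP n) X Z) (u : 𝒢) :
    ProjConf.codiff X Z (conn'.curvFun (j u)) ∈ ProjConf.fTensorWedgeFBar n ∧
      (fun Y => (ProjConf.soPPlus n).mkQ (ProjConf.codiff X Z (conn'.curvFun (j u)) Y)) ∈
        ProjConf.fTensorWedgeF n := by
  have h𝒢a : ProjConf.IsSmoothRightAction EP E act := h𝒢.toIsSmoothRightAction
  have h𝒢a' : ProjConf.IsSmoothRightAction ET E' act' := h𝒢'.toIsSmoothRightAction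
  have key : ∀ {W : Type} [AddCommGroup W] [Module ℝ W]
      (φ : Matrix (ProjConf.Idx n) (ProjConf.Idx n) ℝ →ₗ[ℝ] W)
      (S : Submodule ℝ (ProjConf.soAlg n → W)), _ →
      (fun Y => φ (ProjConf.codiff X Z (fun A B => conn'.curvBilin (j u) A B) Y)) ∈ S :=
    fun φ S hS => ProjConf.codiff_conformal_mem (κ := conn.curvBilin u) hn
      (fun A hA B => conn.curvBilin_eq_zero_left h𝒢a hP u hA B)
      (fun A B hB => conn.curvBilin_eq_zero_right h𝒢a hP u A hB)
      (fun A hA B => conn'.curvBilin_eq_zero_left h𝒢a' hPt (j u) hA B)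
      (fun A B hB => conn'.curvBilin_eq_zero_right h𝒢a' hPt (j u) A hB)
      (ProjConf.curvBilin_induced h𝒢'.smooth_j hconn' u)
      (fun Y => hconn.codiff_eq_zero ProjConf.isDualPair_sl u Y) hXZ φ S hS
  constructor
  · refine key LinearMap.id _ fun a b c ha hb hc => Submodule.subset_span ?_
    obtain ⟨A, hA, hAa⟩ := ProjConf.exists_mem_slP_mulVec_eq_fVec hn ha
    refine ⟨A, hA, _, ProjConf.fVec_mem_FBar hb, _, ProjConf.fVec_mem_FBar hc, funext fun Y => ?_⟩
    rw [ProjConf.confForm_bigsl hAa]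
    rfl
  · refine key (ProjConf.soPPlus n).mkQ _ fun a b c ha hb hc => Submodule.subset_span ?_
    obtain ⟨A, hA, hAa⟩ := ProjConf.exists_mem_slP_mulVec_eq_fVec hn ha
    obtain ⟨B, hB, hBb⟩ := ProjConf.exists_mem_slP_mulVec_eq_fVec hn hb
    obtain ⟨C, hC, hCc⟩ := ProjConf.exists_mem_slP_mulVec_eq_fVec hn hc
    refine ⟨A, hA, B, hB, C, hC, funext fun Y => ?_⟩
    rw [ProjConf.confForm_bigsl hAa, hBb, hCc]
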